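/- Write $\mathbb{C}_n[z]$ (respectively $\mathbb{R}_n[z]$) for the polynomials of degree at most $n$ with complex (respectively real) coefficients. A non-zero polynomial $f\in\mathbb{C}[z]$ is *real-rooted* if all its complex zeros are real (a non-zero constant counts as real-rooted), and *hyperbolic* if in addition its coefficients are real. A polynomial $F\in\mathbb{C}[z,w]$ is *real stable* if it has real coefficients and $F(z,w)\neq 0$ whenever $\operatorname{Im} z>0$ and $\operatorname{Im} w>0$. Let $P,Q$ be hyperbolic with zeros $\alpha_1\le\dots\le\alpha_m$ and $\beta_1\le\dots\le\beta_k$, counted with multiplicity. Their zeros *interlace* if $|m-k|\le 1$ and all of these zeros can be arranged in an alternating chain $\alpha_1\le\beta_1\le\alpha_2\le\beta_2\le\cdots$ or $\beta_1\le\alpha_1\le\beta_2\le\alpha_2\le\cdots$ (so the zeros of any two hyperbolic polynomials of degree $0$ or $1$ interlace). **Theorem.** Let $n\ge 0$ be an integer and let $T:\mathbb{C}_n[z]\to\mathbb{C}[z]$ be a $\mathbb{C}$-linear operator. Extend $T$ to polynomials in $z,w$ of degree at most $n$ in $z$ by $T(z^kw^\ell)=T(z^k)w^\ell$. Then $T$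 maps every real-rooted polynomial of degree at most $n$ to a polynomial that is real-rooted or identically zero if and only if at least one of the following holds: (a) $T$ has range of dimension at most one and is of the form $T(f)=\alpha(f)P$ for $f\in\mathbb{C}_n[z]$, where $\alpha:\mathbb{C}_n[z]\to\mathbb{C}$ is a linear functional and $P$ is hyperbolic; (b) $T$ has range of dimension at most two and is of the form $T(f)=\eta\,\alpha(f)P+\eta\,\beta(f)Q$ for $f\in\mathbb{C}_n[z]$, where $\eta\in\mathbb{C}$, $\alpha,\beta:\mathbb{C}_n[z]\to\mathbb{C}$ are linear functionals with $\alpha(\mathbb{R}_n[z])\subseteq\mathbb{R}$ and $\beta(\mathbb{R}_n[z])\subseteq\mathbb{R}$, and $P,Q$ are hyperbolic polynomials whose zeros interlace; (c) there is $\eta\in\mathbb{C}$ such that $\eta\,T[(z+w)^n]$ is real stable; (d) there is $\eta\in\mathbb{C}$ such that $\eta\,T[(z-w)^n]$ is real stable. -/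

import Mathlib

open Polynomial

noncomputable section

/-- The class of non-zero complex polynomials in one variable all of whose zeros are real. -/
def RealRooted (f : ℂ[X]) : Prop :=
  f ≠ 0 ∧ ∀ z : ℂ, f.eval z = 0 → z.im = 0

/-- A real polynomial in one variable is hyperbolic if it is non-zero and all its complex zeros
are real. -/
def Hyperbolic (P : ℝ[X]) : Prop :=
  P ≠ 0 ∧ ∀ z : ℂ, aeval z P = 0 → z.im = 0

/-- The inclusion of the real polynomials into the complex polynomials. -/
def toComplex (P : ℝ[X]) : ℂ[X] :=
  P.map (algebraMap ℝ ℂ)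

/-- A complex polynomial in several variables is stable if it has no zero all of whose coordinates
have positive imaginary part. -/
def IsStable {σ : Type*} (F : MvPolynomial σ ℂ) : Prop :=
  ∀ z : σ → ℂ, (∀ j, 0 < (z j).im) → MvPolynomial.eval z F ≠ 0

/-- A stable polynomial with real coefficients. -/
def IsRealStable {σ : Type*} (F : MvPolynomial σ ℂ) : Prop :=
  IsStable F ∧ ∀ m, (F.coeff m).im = 0

/-- For (weakly increasing) lists `a = (a₁, …, aₘ)` and `b = (b₁, …, bₖ)`: the chain
`a₁ ≤ b₁ ≤ a₂ ≤ b₂ ≤ ⋯`, which starts with `a`, alternates between the lists and uses up both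
of them (so that `m = k` or `m = k + 1`). -/
def Alternates (a b : List ℝ) : Prop :=
  (a.length = b.length ∨ a.length = b.length + 1) ∧
  (∀ (i : ℕ) (ha : i < a.length) (hb : i < b.length), a[i] ≤ b[i]) ∧
  (∀ (i : ℕ) (ha : i + 1 < a.length) (hb : i < b.length), b[i] ≤ a[i + 1])

/-- The real zeros of a polynomial, with multiplicity, in increasing order. -/
def sortedZeros (P : ℝ[X]) : List ℝ :=
  P.roots.sort (· ≤ ·)

/-- The zeros of two (hyperbolic) polynomials interlace. -/
def ZerosInterlace (P Q : ℝ[X]) : Prop :=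
  Alternates (sortedZeros P) (sortedZeros Q) ∨ Alternates (sortedZeros Q) (sortedZeros P)

/-- The monomial `z ^ k` as an element of the space of polynomials of degree at most `n`. -/
def monomialLE (n k : ℕ) (h : k ≤ n) : degreeLE ℂ (n : WithBot ℕ) :=
  ⟨X ^ k, mem_degreeLE.2 ((degree_X_pow_le k).trans (by exact_mod_cast h))⟩

/-- The extension of `T` to polynomials in the two variables `z = X 0` and `w = X 1`: the linear map
with `z ^ k * w ^ l ↦ T (z ^ k) * w ^ l` for `k ≤ n`. It is meant for polynomials of degree at most
`n` in `z`; monomials of higher degree in `z` are sent to `0`. -/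
def extendTwo {n : ℕ} (T : degreeLE ℂ (n : WithBot ℕ) →ₗ[ℂ] ℂ[X]) :
    MvPolynomial (Fin 2) ℂ →ₗ[ℂ] MvPolynomial (Fin 2) ℂ :=
  (MvPolynomial.basisMonomials (Fin 2) ℂ).constr ℂ fun m =>
    if h : m 0 ≤ n then
      aeval (MvPolynomial.X 0) (T (monomialLE n (m 0) h)) * MvPolynomial.X 1 ^ m 1
    else 0

/-- A complex linear functional on the polynomials of degree at most `n` that takes real values
at the polynomials with real coefficients. -/
def RealOnReal {n : ℕ} (α : degreeLE ℂ (n : WithBot ℕ) →ₗ[ℂ] ℂ) : Prop :=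
  ∀ f : degreeLE ℂ (n : WithBot ℕ), (∀ k, ((f : ℂ[X]).coeff k).im = 0) → (α f).im = 0

end

/-! Sufficiency. For the symbol conditions, fix `z` in the upper half-plane and view `f ↦ T(f)(z)`
as a functional that does not vanish at `(X + w)^n` for `Im w > 0`. By `grace_walsh_szego` it does
not vanish at any product of `n` factors `X + w_j` with `Im w_j > 0`. A real-rooted `f` is, up to a
constant, a limit of multiples of such products, and a Hurwitz argument (`eval_ne_zero_of_tendsto`)
keeps the upper half-plane free of zeros; real coefficients of the symbol give the lower half-plane
by conjugation. For the interlacing case, the arguments of `P(z)` and `Q(z)` differ by an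
alternating sum of angles, which is a multiple of `π` only when the zeros coincide; hence real
combinations are hyperbolic or zero.

Necessity. For `u ≠ 0` and `Im w > 0` the real polynomial `2 Re(u (x + w)^n)` has simple real zeros
and degree at least `n - 1`, so its small perturbations of degree at most `n` are hyperbolic
(`exists_stablyHyperbolic`). If `T` kills a polynomial `f` with this stability, then `T(f + εg) =
εT(g)` shows that every real `g` has a real-rooted or zero image. Such a range is spanned by one
polynomial or, up to a common factor, by an interlacing pair (`parallel_or_interlacing_range`).
Otherwise the images of these polynomials are all real-rooted, and varying the phase of `u` shows
that `T[(z + w)^n]` and `T[(z + w̄)^n]` never have equal modulus for `z`, `w` in the upper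
half-plane. By connectedness one modulus is always the larger, and that term never vanishes
(`stable_or_stable_conj`). Perturbing one image also shows that `T` is real up to a constant, unless
its range is a line (`real_or_parallel_range`). -/

/-! ### Real-rooted polynomials as complex multiples of hyperbolic ones -/

theorem eval_toComplex (P : ℝ[X]) (z : ℂ) : (toComplex P).eval z = aeval z P := by
  simp [toComplex, eval_map_algebraMap]

theorem toComplex_injective : Function.Injective toComplex :=
  map_injective _ (algebraMap ℝ ℂ).injective

@[simp]
theorem toComplex_coeff (P : ℝ[X]) (k : ℕ) : (toComplex P).coeff k = (P.coeff k : ℂ) := by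
  simp [toComplex]

@[simp]
theorem toComplex_add (P Q : ℝ[X]) : toComplex (P + Q) = toComplex P + toComplex Q := by
  simp [toComplex]

@[simp]
theorem toComplex_smul (a : ℝ) (P : ℝ[X]) : toComplex (a • P) = (a : ℂ) • toComplex P := by
  ext k; simp

@[simp]
theorem toComplex_eq_zero {P : ℝ[X]} : toComplex P = 0 ↔ P = 0 := by
  constructor
  · intro h
    exact toComplex_injective (h.trans (by simp [toComplex]))
  · rintro rfl
    simp [toComplex]

theorem exists_toComplex_eq {p : ℂ[X]} (h : ∀ k, (p.coeff k).im = 0) :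
    ∃ P : ℝ[X], toComplex P = p := by
  refine ⟨∑ k ∈ Finset.range (p.natDegree + 1), monomial k (p.coeff k).re, ?_⟩
  ext k
  simp only [toComplex_coeff, finsetSum_coeff, coeff_monomial, Finset.sum_ite_eq',
    Finset.mem_range]
  split_ifs with hk
  · exact Complex.ext rfl (by simp [h k])
  · rw [coeff_eq_zero_of_natDegree_lt (by omega)]; simp

/-- A real polynomial without zeros in the open upper half-plane is hyperbolic. -/
theorem hyperbolic_of_forall_im_pos {P : ℝ[X]} (h : ∀ z : ℂ, 0 < z.im → aeval z P ≠ 0) :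
    Hyperbolic P := by
  refine ⟨?_, fun z hz => ?_⟩
  · rintro rfl
    exact h Complex.I (by simp) (by simp)
  · by_contra hne
    rcases lt_or_gt_of_ne hne with hlt | hgt
    · refine h (starRingEnd ℂ z) (by simpa using hlt) ?_
      rw [aeval_conj, hz, map_zero]
    · exact h z hgt hz

theorem Hyperbolic.aeval_ne_zero {P : ℝ[X]} (h : Hyperbolic P) {z : ℂ} (hz : 0 < z.im) :
    aeval z P ≠ 0 := fun h0 => hz.ne' (h.2 z h0)

theorem Hyperbolic.realRooted_smul {P : ℝ[X]} (h : Hyperbolic P) {c : ℂ} (hc : c ≠ 0) :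
    RealRooted (c • toComplex P) := by
  refine ⟨smul_ne_zero hc (by simpa using h.1), fun z hz => h.2 z ?_⟩
  simpa [hc, eval_toComplex] using hz

theorem RealRooted.of_smul_toComplex {P : ℝ[X]} {c : ℂ} (h : RealRooted (c • toComplex P)) :
    Hyperbolic P := by
  refine ⟨?_, fun z hz => h.2 z ?_⟩
  · rintro rfl
    exact h.1 (by simp [toComplex])
  · simp [eval_toComplex, hz]

/-- A real-rooted polynomial is a multiple of a hyperbolic one. -/
theorem RealRooted.exists_smul_toComplex {f : ℂ[X]} (h : RealRooted f) :
    ∃ (c : ℂ) (P : ℝ[X]), c ≠ 0 ∧ Hyperbolic P ∧ f = c • toComplex P := by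
  have hlc : f.leadingCoeff ≠ 0 := leadingCoeff_ne_zero.2 h.1
  have hf : f = f.leadingCoeff •
      toComplex ((f.roots.map fun a => X - C a.re).prod) := by
    conv_lhs => rw [(IsAlgClosed.splits f).eq_prod_roots]
    rw [smul_eq_C_mul]
    congr 1
    rw [toComplex, Polynomial.map_multiset_prod, Multiset.map_map]
    congr 1
    refine Multiset.map_congr rfl fun a ha => ?_
    have : a.im = 0 := h.2 a (isRoot_of_mem_roots ha)
    have h2 : ((a.re : ℝ) : ℂ) = a := Complex.ext rfl (by simp [this])
    simp [h2]
  refine ⟨f.leadingCoeff, _, hlc, ?_, hf⟩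
  rw [hf] at h
  exact h.of_smul_toComplex

theorem Hyperbolic.splits {P : ℝ[X]} (h : Hyperbolic P) : P.Splits := by
  refine Splits.of_splits_map (algebraMap ℝ ℂ) (IsAlgClosed.splits _) fun z hz => ?_
  have h1 := isRoot_of_mem_roots hz
  have h2 : z.im = 0 := h.2 z (by
    rw [← eval_toComplex]; exact h1)
  exact ⟨z.re, Complex.ext rfl (by simp [h2])⟩

theorem Hyperbolic.aeval_eq {P : ℝ[X]} (h : Hyperbolic P) (z : ℂ) :
    aeval z P = P.leadingCoeff * (P.roots.map fun a : ℝ => z - a).prod := by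
  conv_lhs => rw [h.splits.eq_prod_roots]
  simp [map_multiset_prod, Multiset.map_map]

/-! ### Limits of polynomials without zeros in the upper half-plane -/

theorem Multiset.norm_prod_sub_le {s : Multiset ℂ} {z x : ℂ}
    (hs : ∀ r ∈ s, ‖z - r‖ ≤ 2 * ‖x - r‖) :
    ‖(s.map fun r => z - r).prod‖ ≤ 2 ^ s.card * ‖(s.map fun r => x - r).prod‖ := by
  induction s using Multiset.induction with
  | empty => simp
  | cons a s ih =>
    simp only [Multiset.map_cons, Multiset.prod_cons, norm_mul, Multiset.card_cons]
    have h1 := hs a (by simp)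
    have h2 := ih fun r hr => hs r (by simp [hr])
    calc _ ≤ (2 * ‖x - a‖) * (2 ^ s.card * ‖(s.map fun r => x - r).prod‖) := by gcongr
      _ = _ := by ring

/-- Every root is at distance at least `Im x` from `x`, so moving by at most `Im x` at most doubles
each factor. The constant depends only on the degree, so in a limit a zero at `x` spreads to a whole
disc. -/
theorem norm_eval_le_of_stable {p : ℂ[X]} (hp : ∀ z : ℂ, 0 < z.im → p.eval z ≠ 0) {N : ℕ}
    (hN : p.natDegree ≤ N) {z x : ℂ} (hz : ‖z - x‖ ≤ x.im) :
    ‖p.eval z‖ ≤ 2 ^ N * ‖p.eval x‖ := by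
  have hs := IsAlgClosed.splits p
  have hroots : ∀ r ∈ p.roots, ‖z - r‖ ≤ 2 * ‖x - r‖ := by
    intro r hr
    have hr0 : r.im ≤ 0 := not_lt.1 fun h => hp r h (isRoot_of_mem_roots hr)
    have h1 : x.im ≤ ‖x - r‖ := by
      have := Complex.abs_im_le_norm (x - r)
      have h3 := le_abs_self (x - r).im
      rw [Complex.sub_im] at this h3
      linarith
    have h2 : ‖z - r‖ ≤ ‖z - x‖ + ‖x - r‖ := by
      simpa using norm_add_le (z - x) (x - r)
    linarith
  rw [hs.eval_eq_prod_roots, hs.eval_eq_prod_roots, norm_mul, norm_mul]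
  have h := Multiset.norm_prod_sub_le hroots
  have hcard : (2 : ℝ) ^ p.roots.card ≤ 2 ^ N :=
    pow_le_pow_right₀ (by norm_num) ((card_roots' p).trans hN)
  calc _ ≤ ‖p.leadingCoeff‖ * (2 ^ N * ‖(p.roots.map fun r => x - r).prod‖) := by
        gcongr
        exact h.trans (by gcongr)
    _ = _ := by ring

/-- A limit of polynomials of bounded degree without zeros in the open upper half-plane vanishes
identically or has no zeros there. -/
theorem eval_ne_zero_of_tendsto {ι : Type*} {l : Filter ι} [l.NeBot] {p : ι → ℂ[X]} {q : ℂ[X]}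
    {N : ℕ} (hp : ∀ᶠ i in l, (∀ z : ℂ, 0 < z.im → (p i).eval z ≠ 0) ∧ (p i).natDegree ≤ N)
    (hlim : ∀ z, Filter.Tendsto (fun i => (p i).eval z) l (nhds (q.eval z))) (hq : q ≠ 0)
    {x : ℂ} (hx : 0 < x.im) : q.eval x ≠ 0 := by
  intro h0
  have hball : ∀ z ∈ Metric.closedBall x x.im, q.eval z = 0 := by
    intro z hz
    rw [Metric.mem_closedBall, dist_eq_norm] at hz
    have h1 : ‖q.eval z‖ ≤ 2 ^ N * ‖q.eval x‖ := by
      refine le_of_tendsto_of_tendsto (hlim z).norm ((hlim x).norm.const_mul _) ?_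
      filter_upwards [hp] with i hi
      exact norm_eval_le_of_stable hi.1 hi.2 hz
    simpa [h0] using h1
  refine hq (Polynomial.eq_zero_of_infinite_isRoot q ?_)
  refine Set.Infinite.mono (s := Metric.closedBall x x.im) hball ?_
  exact (infinite_of_mem_nhds x (Metric.closedBall_mem_nhds x hx))

/-! ### The Grace–Walsh–Szegő theorem for the upper half-plane -/

/-- Inversion maps the half-plane `Im ζ ≥ Im w`, which contains `w - r`, into this disc, whose
boundary circle passes through `0`. -/
theorem norm_inv_sub_le {w r : ℂ} (hw : 0 < w.im) (hr : r.im ≤ 0) :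
    ‖(w - r)⁻¹ + Complex.I / (2 * w.im)‖ ≤ 1 / (2 * w.im) := by
  have hne : w - r ≠ 0 := fun h => by
    have := congrArg Complex.im h
    simp at this; linarith
  have hw' : (w.im : ℂ) ≠ 0 := by exact_mod_cast hw.ne'
  have h1 : (w - r)⁻¹ + Complex.I / (2 * w.im) =
      (2 * w.im + Complex.I * (w - r)) / ((2 * w.im) * (w - r)) := by
    field_simp
  have h2 : ‖2 * (w.im : ℂ) + Complex.I * (w - r)‖ ≤ ‖w - r‖ := by
    rw [← sq_le_sq₀ (norm_nonneg _) (norm_nonneg _), Complex.sq_norm, Complex.sq_norm,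
      Complex.normSq_apply, Complex.normSq_apply]
    simp
    nlinarith
  rw [h1, norm_div, norm_mul]
  have h3 : ‖(2 * (w.im : ℂ))‖ = 2 * w.im := by
    rw [norm_mul, Complex.norm_real, Real.norm_of_nonneg hw.le]; simp
  rw [h3, div_le_div_iff₀ (by have := norm_pos_iff.2 hne; positivity) (by positivity)]
  have := norm_nonneg (w - r)
  nlinarith

theorem Multiset.norm_sum_sub_le {s : Multiset ℂ} {c : ℂ} {ρ : ℝ} (hs : ∀ u ∈ s, ‖u - c‖ ≤ ρ) :
    ‖s.sum - s.card * c‖ ≤ s.card * ρ := by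
  induction s using Multiset.induction with
  | empty => simp
  | cons a s ih =>
    have h1 := hs a (by simp)
    have h2 := ih fun r hr => hs r (by simp [hr])
    simp only [Multiset.sum_cons, Multiset.card_cons, Nat.cast_add, Nat.cast_one]
    calc _ = ‖(a - c) + (s.sum - s.card * c)‖ := by ring_nf
      _ ≤ ‖a - c‖ + ‖s.sum - s.card * c‖ := norm_add_le _ _
      _ ≤ _ := by linarith

/-- Laguerre's theorem on polar derivatives, for the upper half-plane. -/
theorem polar_derivative_ne_zero {q : ℂ[X]} {N : ℕ} (hN : q.natDegree ≤ N) (hN0 : 0 < N)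
    (hq : ∀ w : ℂ, 0 < w.im → q.eval w ≠ 0) {w v : ℂ} (hw : 0 < w.im) (hv : 0 < v.im) :
    N * q.eval w + (v - w) * (derivative q).eval w ≠ 0 := by
  intro h0
  have hqw := hq w hw
  have hNC : (N : ℂ) ≠ 0 := by exact_mod_cast hN0.ne'
  have hwv : w - v ≠ 0 := by
    intro h
    have : v - w = 0 := by rw [← neg_sub, h, neg_zero]
    rw [this, zero_mul, add_zero] at h0
    exact (mul_ne_zero hNC hqw) h0
  have hsum := (IsAlgClosed.splits q).eval_derivative_div_eval_of_ne_zero hqw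
  -- A zero of the polar derivative makes the logarithmic derivative equal to that of `(X - v)^N`.
  have hu : (derivative q).eval w / q.eval w = N * (w - v)⁻¹ := by
    field_simp
    linear_combination -h0
  rw [hu] at hsum
  set c : ℂ := -(Complex.I / (2 * w.im)) with hc
  have hρ : ∀ u ∈ q.roots.map (fun z => 1 / (w - z)), ‖u - c‖ ≤ 1 / (2 * w.im) := by
    intro u hu
    obtain ⟨r, hr, rfl⟩ := Multiset.mem_map.1 hu
    have hr0 : r.im ≤ 0 := not_lt.1 fun h => hq r h (isRoot_of_mem_roots hr)
    simpa [hc] using norm_inv_sub_le hw hr0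
  have hle := Multiset.norm_sum_sub_le hρ
  rw [← hsum, Multiset.card_map] at hle
  set d := q.roots.card
  have hd : (d : ℝ) ≤ N := by exact_mod_cast (card_roots' q).trans hN
  have hcn : ‖c‖ = 1 / (2 * w.im) := by
    rw [hc, norm_neg, norm_div, Complex.norm_I, norm_mul, Complex.norm_real,
      Real.norm_of_nonneg hw.le]; simp
  -- The `N - d` missing roots count as roots at infinity: each contributes `0`, which lies on the
  -- boundary of the disc. So `(w - v)⁻¹` is an average of `N` points of the disc, which will force
  -- `Im v ≤ 0`.
  have h1 : ‖(N : ℂ) * (w - v)⁻¹ - N * c‖ ≤ N * (1 / (2 * w.im)) := by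
    calc _ = ‖((N : ℂ) * (w - v)⁻¹ - d * c) - (N - d : ℝ) * c‖ := by push_cast; ring_nf
      _ ≤ _ := norm_sub_le _ _
      _ ≤ d * (1 / (2 * w.im)) + (N - d) * (1 / (2 * w.im)) := by
        gcongr
        rw [norm_mul, Complex.norm_real, Real.norm_of_nonneg (by linarith), hcn]
      _ = _ := by ring
  have h2 : ‖(w - v)⁻¹ - c‖ ≤ 1 / (2 * w.im) := by
    rw [← mul_sub, norm_mul, Complex.norm_natCast] at h1
    exact le_of_mul_le_mul_left h1 (by exact_mod_cast hN0)
  have hw' : (w.im : ℂ) ≠ 0 := by exact_mod_cast hw.ne'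
  have h3 : (w - v)⁻¹ - c = (2 * w.im + Complex.I * (w - v)) / ((2 * w.im) * (w - v)) := by
    rw [hc]; field_simp; ring
  have h4 : ‖(2 * (w.im : ℂ))‖ = 2 * w.im := by
    rw [norm_mul, Complex.norm_real, Real.norm_of_nonneg hw.le]; simp
  have h5 := norm_pos_iff.2 hwv
  rw [h3, norm_div, norm_mul, h4, div_le_div_iff₀ (by positivity) (by positivity), one_mul] at h2
  have h6 : ‖2 * (w.im : ℂ) + Complex.I * (w - v)‖ ≤ ‖w - v‖ := by
    refine le_of_mul_le_mul_right (h2.trans (le_of_eq (mul_comm _ _))) (by positivity)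
  rw [← sq_le_sq₀ (norm_nonneg _) (norm_nonneg _), Complex.sq_norm, Complex.sq_norm,
    Complex.normSq_apply, Complex.normSq_apply] at h6
  simp at h6
  nlinarith [mul_pos hw hv]

/-- The polynomial `w ↦ φ ((z + w) ^ n)`. -/
theorem exists_polynomial_eval_eq (φ : ℂ[X] →ₗ[ℂ] ℂ) (n : ℕ) :
    ∃ q : ℂ[X], q.natDegree ≤ n ∧ (∀ w, q.eval w = φ ((X + C w) ^ n)) ∧
      ∀ w, (derivative q).eval w = n * φ ((X + C w) ^ (n - 1)) := by
  have key : ∀ (n : ℕ) (w : ℂ), φ ((X + C w) ^ n) =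
      ∑ k ∈ Finset.range (n + 1), w ^ k * (φ (X ^ (n - k)) * (n.choose k)) := by
    intro n w
    rw [add_comm, add_pow, map_sum]
    refine Finset.sum_congr rfl fun k _ => ?_
    have : C w ^ k * X ^ (n - k) * ((n.choose k : ℕ) : ℂ[X]) =
        (w ^ k * (n.choose k : ℂ)) • X ^ (n - k) := by
      rw [smul_eq_C_mul, C_mul, C_pow, C_eq_natCast]; ring
    rw [this, map_smul, smul_eq_mul]; ring
  refine ⟨∑ k ∈ Finset.range (n + 1), C (φ (X ^ (n - k)) * (n.choose k)) * X ^ k,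
    ?_, fun w => ?_, fun w => ?_⟩
  · refine natDegree_sum_le_of_forall_le _ _ fun k hk => ?_
    exact (natDegree_C_mul_X_pow_le _ _).trans (by simpa [Nat.lt_succ_iff] using hk)
  · rw [key, eval_finsetSum]
    refine Finset.sum_congr rfl fun k _ => ?_
    simp; ring
  · rw [derivative_sum, eval_finsetSum, Finset.sum_range_succ', key]
    rcases n with _ | n
    · simp
    · simp only [Nat.add_sub_cancel]
      rw [Finset.mul_sum]
      simp only [derivative_C_mul_X_pow, eval_mul, eval_C, eval_pow, eval_X, Nat.cast_zero,
        mul_zero, zero_mul, add_zero]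
      refine Finset.sum_congr rfl fun k _ => ?_
      have h := Nat.add_one_mul_choose_eq n k
      have h' : ((n : ℂ) + 1) * n.choose k = (n + 1).choose (k + 1) * (k + 1) := by
        exact_mod_cast h
      rw [show n + 1 - (k + 1) = n - k by omega, show k + 1 - 1 = k by omega]
      push_cast
      linear_combination (-(w ^ k * φ (X ^ (n - k)))) * h'

/-- Factors are split off one at a time: absorbing `X + C v` into the functional leaves the same
problem in degree one less, and its hypothesis is the non-vanishing of the polar derivative of `w ↦
φ((X + w)^n)` with pole `v`. -/
theorem grace_walsh_szego (n : ℕ) (φ : ℂ[X] →ₗ[ℂ] ℂ)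
    (hφ : ∀ w : ℂ, 0 < w.im → φ ((X + C w) ^ n) ≠ 0) (s : Multiset ℂ) (hs : s.card = n)
    (hpos : ∀ w ∈ s, 0 < w.im) : φ ((s.map fun w => X + C w).prod) ≠ 0 := by
  induction s using Multiset.induction generalizing n φ with
  | empty =>
    have := hφ Complex.I (by simp)
    simp at hs
    subst hs
    simpa using this
  | cons v s ih =>
    rw [Multiset.card_cons] at hs
    obtain ⟨m, rfl⟩ : ∃ m, n = m + 1 := ⟨s.card, hs.symm⟩
    have hv := hpos v (by simp)
    rw [Multiset.map_cons, Multiset.prod_cons]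
    refine ih m (φ ∘ₗ LinearMap.mulLeft ℂ (X + C v)) (fun w hw => ?_) (by omega)
      (fun w hw => hpos w (by simp [hw]))
    obtain ⟨q, hdeg, hq, hq'⟩ := exists_polynomial_eval_eq φ (m + 1)
    have h := polar_derivative_ne_zero hdeg (by omega) (fun w hw => (hq w).symm ▸ hφ w hw) hw hv
    rw [hq, hq', Nat.add_sub_cancel] at h
    intro h0
    apply h
    have h1 : (X + C v) * (X + C w) ^ m = (X + C w) ^ (m + 1) + (v - w) • (X + C w) ^ m := by
      rw [smul_eq_C_mul, C_sub]; ring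
    have h2 : φ ((X + C w) ^ (m + 1)) + (v - w) * φ ((X + C w) ^ m) = 0 := by
      simpa [h1] using h0
    linear_combination ((m + 1 : ℕ) : ℂ) * h2

theorem LinearMap.map_eq_sum_coeff {M : Type*} [AddCommGroup M] [Module ℂ M]
    (L : ℂ[X] →ₗ[ℂ] M) {n : ℕ} {p : ℂ[X]} (hp : p.natDegree ≤ n) :
    L p = ∑ k ∈ Finset.range (n + 1), p.coeff k • L (X ^ k) := by
  conv_lhs => rw [p.as_sum_range' (n + 1) (by omega), map_sum]
  refine Finset.sum_congr rfl fun k _ => ?_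
  rw [← map_smul, smul_X_eq_monomial]

theorem Multiset.natDegree_prod_X_add_C {R : Type*} [CommRing R] [Nontrivial R] (s : Multiset R) :
    ((s.map fun w => X + C w).prod).natDegree = s.card := by
  rw [natDegree_multiset_prod_of_monic]
  · simp
  · intro p hp
    obtain ⟨a, -, rfl⟩ := Multiset.mem_map.1 hp
    exact monic_X_add_C a

/-- A linear operator whose values at `(z + w) ^ n` have no zeros for `z` and `w` in the upper
half-plane maps real-rooted polynomials to polynomials without zeros there, or to zero. -/
theorem eval_map_ne_zero_of_stable {L : ℂ[X] →ₗ[ℂ] ℂ[X]} {n : ℕ}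
    (hL : ∀ z w : ℂ, 0 < z.im → 0 < w.im → (L ((X + C w) ^ n)).eval z ≠ 0)
    {f : ℂ[X]} (hf : RealRooted f) (hdeg : f.natDegree ≤ n) (h0 : L f ≠ 0)
    {x : ℂ} (hx : 0 < x.im) : (L f).eval x ≠ 0 := by
  set d := f.roots.card with hd
  have hdn : d ≤ n := (card_roots' f).trans hdeg
  -- The inner variable is `ε`. The roots of `f` move down by `ε`, and the `n - d` missing factors
  -- become `1 - iεX = -iε(X + i/ε)`, so for `ε > 0` there are exactly `n` factors `X + w` with `Im
  -- w > 0`; at `ε = 0` the monic multiple of `f` returns.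
  let G : ℂ[X][X] := (f.roots.map fun a => X + C (C (-a) + C Complex.I * X)).prod *
    (1 + C (C (-Complex.I) * X) * X) ^ (n - d)
  let g : ℂ → ℂ[X] := fun ε => G.map (evalRingHom ε)
  have hg : ∀ ε, g ε = (f.roots.map fun a => X + C (-a + Complex.I * ε)).prod *
      (1 + C (-Complex.I * ε) * X) ^ (n - d) := by
    intro ε
    simp [g, G, Polynomial.map_multiset_prod, Multiset.map_map]
  have hcoeff : ∀ k, Continuous fun ε : ℝ => (g ε).coeff k := by
    intro k
    have : (fun ε : ℝ => (g ε).coeff k) = fun ε : ℝ => (G.coeff k).eval (ε : ℂ) := by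
      ext ε; simp [g]
    rw [this]
    exact (G.coeff k).continuous.comp Complex.continuous_ofReal
  have hgdeg : ∀ ε, (g ε).natDegree ≤ n := by
    intro ε
    rw [hg]
    refine natDegree_mul_le.trans ?_
    have h1 : ((f.roots.map fun a => X + C (-a + Complex.I * ε)).prod).natDegree = d := by
      have := Multiset.natDegree_prod_X_add_C (f.roots.map fun a => -a + Complex.I * ε)
      simpa [Multiset.map_map, Function.comp_def] using this
    have h2 : ((1 + C (-Complex.I * ε) * X : ℂ[X]) ^ (n - d)).natDegree ≤ n - d := by
      have h3 : (1 + C (-Complex.I * ε) * X : ℂ[X]).natDegree ≤ 1 := by compute_degree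
      calc _ ≤ (n - d) * (1 + C (-Complex.I * ε) * X : ℂ[X]).natDegree := natDegree_pow_le
        _ ≤ (n - d) * 1 := Nat.mul_le_mul_left _ h3
        _ = _ := mul_one _
    omega
  have hstable : ∀ ε : ℝ, 0 < ε → ∀ z : ℂ, 0 < z.im → (L (g ε)).eval z ≠ 0 := by
    intro ε hε z hz
    have hεC : (ε : ℂ) ≠ 0 := by exact_mod_cast hε.ne'
    let s : Multiset ℂ := (f.roots.map fun a => -a + Complex.I * ε) +
      Multiset.replicate (n - d) (Complex.I / ε)
    have hs : s.card = n := by simp [s, ← hd]; omega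
    have hpos : ∀ w ∈ s, 0 < w.im := by
      intro w hw
      rcases Multiset.mem_add.1 hw with hw | hw
      · obtain ⟨a, ha, rfl⟩ := Multiset.mem_map.1 hw
        have : a.im = 0 := hf.2 a (isRoot_of_mem_roots ha)
        simpa [this] using hε
      · rw [Multiset.eq_of_mem_replicate hw]
        simpa [Complex.div_ofReal_im] using hε
    have hgs : g ε = (-Complex.I * ε) ^ (n - d) • (s.map fun w => X + C w).prod := by
      have h1 : (1 + C (-Complex.I * ε) * X : ℂ[X]) =
          C (-Complex.I * ε) * (X + C (Complex.I / ε)) := by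
        rw [mul_add, ← C_mul, show -Complex.I * ε * (Complex.I / ε) = 1 by
          field_simp; rw [Complex.I_sq]; norm_num, C_1, add_comm]
      rw [hg, h1, mul_pow, smul_eq_C_mul, C_pow]
      simp only [s, Multiset.map_add, Multiset.prod_add, Multiset.map_map, Multiset.map_replicate,
        Multiset.prod_replicate, Function.comp_def]
      ring
    rw [hgs, map_smul, eval_smul, smul_eq_mul]
    refine mul_ne_zero (pow_ne_zero _ (mul_ne_zero (neg_ne_zero.2 Complex.I_ne_zero) hεC)) ?_
    exact grace_walsh_szego n (leval z ∘ₗ L) (fun w hw => hL z w hz hw) s hs hpos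
  have hf0 : f = f.leadingCoeff • g ((0 : ℝ) : ℂ) := by
    rw [hg]
    conv_lhs => rw [(IsAlgClosed.splits f).eq_prod_roots]
    simp [smul_eq_C_mul, sub_eq_add_neg]
  have hlc : f.leadingCoeff ≠ 0 := leadingCoeff_ne_zero.2 hf.1
  rw [hf0, map_smul] at h0 ⊢
  rw [eval_smul, smul_eq_mul]
  refine mul_ne_zero hlc ?_
  let N := (Finset.range (n + 1)).sup fun k => (L (X ^ k)).natDegree
  refine eval_ne_zero_of_tendsto (l := nhdsWithin (0 : ℝ) (Set.Ioi 0))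
    (p := fun ε : ℝ => L (g ε)) (N := N) ?_ (fun z => ?_) (right_ne_zero_of_smul h0) hx
  · filter_upwards [self_mem_nhdsWithin] with ε hε
    refine ⟨hstable ε hε, ?_⟩
    rw [L.map_eq_sum_coeff (hgdeg ε)]
    refine natDegree_sum_le_of_forall_le _ _ fun k hk => ?_
    exact (natDegree_smul_le _ _).trans (Finset.le_sup (f := fun k => (L (X ^ k)).natDegree) hk)
  · have hc : Continuous fun ε : ℝ => (L (g ε)).eval z := by
      have : (fun ε : ℝ => (L (g ε)).eval z) = fun ε : ℝ =>
          ∑ k ∈ Finset.range (n + 1), (g ε).coeff k * (L (X ^ k)).eval z := by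
        ext ε
        rw [L.map_eq_sum_coeff (hgdeg ε), eval_finsetSum]
        simp
      rw [this]
      exact continuous_finsetSum _ fun k _ => (hcoeff k).mul continuous_const
    exact (hc.tendsto 0).mono_left nhdsWithin_le_nhds

/-- The operator is a multiple of one with real coefficients. -/
theorem exists_map_toComplex_eq {L : ℂ[X] →ₗ[ℂ] ℂ[X]} {n : ℕ} {c : ℂ}
    (hr : ∀ k ≤ n, ∃ r : ℝ[X], L (X ^ k) = c • toComplex r) {P : ℝ[X]} (hP : P.natDegree ≤ n) :
    ∃ R : ℝ[X], L (toComplex P) = c • toComplex R := by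
  choose! r hr using hr
  refine ⟨∑ k ∈ Finset.range (n + 1), P.coeff k • r k, ?_⟩
  have hdeg : (toComplex P).natDegree ≤ n := natDegree_map_le.trans hP
  rw [L.map_eq_sum_coeff hdeg, toComplex.eq_def (Finset.sum _ _),
    Polynomial.map_sum, Finset.smul_sum]
  refine Finset.sum_congr rfl fun k hk => ?_
  rw [hr k (Nat.lt_succ_iff.1 (Finset.mem_range.1 hk)), smul_comm]
  congr 1
  rw [← toComplex, toComplex_smul, toComplex_coeff]

theorem natDegree_of_smul_toComplex {c : ℂ} (hc : c ≠ 0) (P : ℝ[X]) :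
    (c • toComplex P).natDegree = P.natDegree := by
  rw [natDegree_smul _ hc, toComplex, natDegree_map]

/-- Stability rules out zeros in the upper half-plane only; the lower one follows by conjugation,
because the image is a multiple of a real polynomial. -/
theorem realRooted_map_of_stable {L : ℂ[X] →ₗ[ℂ] ℂ[X]} {n : ℕ} {c : ℂ}
    (hL : ∀ z w : ℂ, 0 < z.im → 0 < w.im → (L ((X + C w) ^ n)).eval z ≠ 0)
    (hr : ∀ k ≤ n, ∃ r : ℝ[X], L (X ^ k) = c • toComplex r)
    {f : ℂ[X]} (hf : RealRooted f) (hdeg : f.natDegree ≤ n) :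
    RealRooted (L f) ∨ L f = 0 := by
  by_cases h0 : L f = 0
  · exact Or.inr h0
  left
  obtain ⟨b, P, hb, hP, rfl⟩ := hf.exists_smul_toComplex
  obtain ⟨R, hR⟩ := exists_map_toComplex_eq hr ((natDegree_of_smul_toComplex hb P).symm.le.trans hdeg)
  have h1 : L (b • toComplex P) = (b * c) • toComplex R := by rw [map_smul, hR, smul_smul]
  have hbc : b * c ≠ 0 := by
    intro h
    rw [h1, h, zero_smul] at h0
    exact h0 rfl
  have hst := fun z hz => eval_map_ne_zero_of_stable hL hf hdeg h0 (x := z) hz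
  rw [h1]
  refine Hyperbolic.realRooted_smul (hyperbolic_of_forall_im_pos fun z hz h => hst z hz ?_) hbc
  rw [h1, eval_smul, eval_toComplex, h, smul_zero]

/-! ### Arguments of the values of a hyperbolic polynomial -/

/-- The argument of `z - a`, for `z` in the upper half-plane. -/
noncomputable def upperArg (z : ℂ) (a : ℝ) : ℝ :=
  Real.pi / 2 + Real.arctan ((a - z.re) / z.im)

theorem upperArg_pos (z : ℂ) (a : ℝ) : 0 < upperArg z a := by
  have := Real.neg_pi_div_two_lt_arctan ((a - z.re) / z.im)
  unfold upperArg; linarith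

theorem upperArg_lt_pi (z : ℂ) (a : ℝ) : upperArg z a < Real.pi := by
  have := Real.arctan_lt_pi_div_two ((a - z.re) / z.im)
  unfold upperArg; linarith

theorem upperArg_strictMono {z : ℂ} (hz : 0 < z.im) : StrictMono (upperArg z) := by
  intro a b hab
  unfold upperArg
  have : (a - z.re) / z.im < (b - z.re) / z.im := by gcongr
  have := Real.arctan_strictMono this
  linarith

theorem exists_sub_eq_mul_exp {z : ℂ} (hz : 0 < z.im) (a : ℝ) :
    ∃ R : ℝ, R ≠ 0 ∧ z - a = R * Complex.exp (upperArg z a * Complex.I) := by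
  set u := (a - z.re) / z.im with hu
  have hs : 0 < √(1 + u ^ 2) := Real.sqrt_pos.2 (by positivity)
  refine ⟨z.im * √(1 + u ^ 2), by positivity, ?_⟩
  have h1 : Real.cos (upperArg z a) = -(u / √(1 + u ^ 2)) := by
    rw [upperArg, ← hu, add_comm, Real.cos_add_pi_div_two, Real.sin_arctan]
  have h2 : Real.sin (upperArg z a) = 1 / √(1 + u ^ 2) := by
    rw [upperArg, ← hu, add_comm, Real.sin_add_pi_div_two, Real.cos_arctan]
  have hu' : z.im * u = a - z.re := by rw [hu]; field_simp
  rw [Complex.exp_mul_I, ← Complex.ofReal_cos, ← Complex.ofReal_sin, h1, h2]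
  have e1 : z.im * √(1 + u ^ 2) * -(u / √(1 + u ^ 2)) = z.re - a := by
    field_simp
    linarith
  have e2 : z.im * √(1 + u ^ 2) * (1 / √(1 + u ^ 2)) = z.im := by field_simp
  rw [mul_add, ← mul_assoc, ← Complex.ofReal_mul, ← Complex.ofReal_mul, e1, e2]
  apply Complex.ext <;> simp

/-- The argument, up to multiples of `π`, of the value of a hyperbolic polynomial. -/
noncomputable def totalArg (P : ℝ[X]) (z : ℂ) : ℝ :=
  (P.roots.map (upperArg z)).sum

theorem Hyperbolic.exists_aeval_eq {P : ℝ[X]} (h : Hyperbolic P) {z : ℂ} (hz : 0 < z.im) :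
    ∃ R : ℝ, R ≠ 0 ∧ aeval z P = R * Complex.exp (totalArg P z * Complex.I) := by
  have key : ∀ s : Multiset ℝ, ∃ R : ℝ, R ≠ 0 ∧ (s.map fun a : ℝ => z - a).prod =
      R * Complex.exp ((s.map (upperArg z)).sum * Complex.I) := by
    intro s
    induction s using Multiset.induction with
    | empty => exact ⟨1, by simp⟩
    | cons a s ih =>
      obtain ⟨R, hR, h⟩ := ih
      obtain ⟨R', hR', h'⟩ := exists_sub_eq_mul_exp hz a
      refine ⟨R' * R, mul_ne_zero hR' hR, ?_⟩
      simp only [Multiset.map_cons, Multiset.prod_cons, Multiset.sum_cons, h, h']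
      push_cast
      rw [add_mul, Complex.exp_add]
      ring
  obtain ⟨R, hR, hp⟩ := key P.roots
  refine ⟨P.leadingCoeff * R, mul_ne_zero (leadingCoeff_ne_zero.2 h.1) hR, ?_⟩
  rw [h.aeval_eq, hp, totalArg]
  push_cast; ring

/-- The quotient `P(z)/Q(z)` is real exactly when the arguments agree modulo `π`, that is, when some
`P - sQ` vanishes at `z`. -/
theorem sin_totalArg_sub_eq_zero_iff {P Q : ℝ[X]} (hP : Hyperbolic P) (hQ : Hyperbolic Q) {z : ℂ}
    (hz : 0 < z.im) : Real.sin (totalArg P z - totalArg Q z) = 0 ↔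
      ∃ s : ℝ, aeval z P = s * aeval z Q := by
  obtain ⟨R, hR, h⟩ := hP.exists_aeval_eq hz
  obtain ⟨R', hR', h'⟩ := hQ.exists_aeval_eq hz
  set D := totalArg P z - totalArg Q z with hD
  have hPQ : aeval z P = (R / R') * Complex.exp (D * Complex.I) * aeval z Q := by
    have : (R' : ℂ) ≠ 0 := by exact_mod_cast hR'
    rw [h, h', hD]
    push_cast
    rw [sub_mul, Complex.exp_sub]
    field_simp
  have hQz := hQ.aeval_ne_zero hz
  rw [Complex.exp_mul_I, ← Complex.ofReal_cos, ← Complex.ofReal_sin] at hPQ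
  constructor
  · intro hs
    refine ⟨R / R' * Real.cos D, ?_⟩
    rw [hPQ, hs]; push_cast; ring
  · rintro ⟨s, hs⟩
    rw [hPQ] at hs
    have := congrArg Complex.im (mul_right_cancel₀ hQz hs)
    rw [← Complex.ofReal_div, Complex.im_ofReal_mul] at this
    simpa [hR, hR', -Complex.ofReal_cos, -Complex.ofReal_sin] using this

/-! ### Interlacing polynomials -/

theorem Alternates.tail {x : ℝ} {a b : List ℝ} (h : Alternates (x :: a) b) : Alternates b a := by
  obtain ⟨hl, h1, h2⟩ := h
  simp only [List.length_cons] at hl h1 h2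
  refine ⟨by omega, fun i hb ha => ?_, fun i hb ha => ?_⟩
  · exact h2 i (by omega) hb
  · exact h1 (i + 1) (by omega) hb

/-- The difference is an alternating sum of increasing numbers below `M`; removing the first entry
exchanges the two lists and drives the recursion. With angles in `(0, π)` the difference lies in
`(-π, 0]` for equal lengths and in `(0, π)` otherwise. The last clause of each half tracks equality
through the recursion. -/
theorem Alternates.sum_sub_sum {θ : ℝ → ℝ} {M : ℝ} (hθ : StrictMono θ) (hM : ∀ x, θ x < M) :
    ∀ (x : ℝ) (a b : List ℝ), Alternates (x :: a) b →
      (b.length = a.length + 1 →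
        θ x - M < (θ x + (a.map θ).sum) - (b.map θ).sum ∧
        (θ x + (a.map θ).sum) - (b.map θ).sum ≤ 0 ∧
        ((θ x + (a.map θ).sum) - (b.map θ).sum = 0 → x :: a = b)) ∧
      (b.length = a.length →
        θ x ≤ (θ x + (a.map θ).sum) - (b.map θ).sum ∧
        (θ x + (a.map θ).sum) - (b.map θ).sum < M ∧
        ((a.map θ).sum - (b.map θ).sum = 0 → b = a))
  | x, a, [], h => by
    refine ⟨fun hl => by simp at hl, fun hl => ?_⟩
    have ha : a = [] := List.length_eq_zero_iff.1 (by simpa using hl.symm)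
    subst ha
    simpa using hM x
  | x, a, y :: b, h => by
    have hxy : x ≤ y := h.2.1 0 (by simp) (by simp)
    have hθxy : θ x ≤ θ y := hθ.monotone hxy
    have hMx := hM x
    have hMy := hM y
    obtain ⟨ih1, ih2⟩ := Alternates.sum_sub_sum hθ hM y b a h.tail
    simp only [List.length_cons, List.map_cons, List.sum_cons]
    refine ⟨fun hl => ?_, fun hl => ?_⟩
    · obtain ⟨h1, h2, h3⟩ := ih2 (by omega)
      refine ⟨by linarith, by linarith, fun h0 => ?_⟩
      have hx : θ x = θ y := by linarith
      rw [hθ.injective hx, h3 (by linarith)]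
    · obtain ⟨h1, h2, h3⟩ := ih1 (by omega)
      exact ⟨by linarith, by linarith, fun h0 => h3 (by linarith)⟩
termination_by _ a b => a.length + b.length
decreasing_by simp; omega

theorem totalArg_eq (P : ℝ[X]) (z : ℂ) :
    totalArg P z = ((sortedZeros P).map (upperArg z)).sum := by
  rw [totalArg, sortedZeros, ← Multiset.sum_coe, ← Multiset.map_coe, Multiset.sort_eq]

theorem roots_eq_of_totalArg {P Q : ℝ[X]} (h : Alternates (sortedZeros P) (sortedZeros Q))
    {z : ℂ} (hz : 0 < z.im) (hs : Real.sin (totalArg P z - totalArg Q z) = 0) :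
    P.roots = Q.roots := by
  suffices h : sortedZeros P = sortedZeros Q by
    rw [← Multiset.sort_eq P.roots (· ≤ ·), ← Multiset.sort_eq Q.roots (· ≤ ·)]
    exact congrArg _ h
  rw [totalArg_eq, totalArg_eq] at hs
  generalize sortedZeros P = a at *
  generalize sortedZeros Q = b at *
  match a, h, hs with
  | [], h, hs =>
    have := h.1
    simp at this
    exact (List.length_eq_zero_iff.1 this.symm).symm
  | x :: a, h, hs =>
    have hl := h.1
    simp only [List.length_cons, add_left_inj] at hl
    simp only [List.map_cons, List.sum_cons] at hs
    obtain ⟨h1, h2⟩ := Alternates.sum_sub_sum (upperArg_strictMono hz) (upperArg_lt_pi z) x a b h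
    have hx := upperArg_pos z x
    rcases hl with hl | hl
    · obtain ⟨h3, h4, h5⟩ := h1 hl.symm
      refine h5 (le_antisymm h4 (not_lt.1 fun hlt => ?_))
      exact (Real.sin_neg_of_neg_of_neg_pi_lt hlt (by linarith)).ne hs
    · obtain ⟨h3, h4, -⟩ := h2 hl.symm
      exact absurd hs (Real.sin_pos_of_pos_of_lt_pi (by linarith) h4).ne'

theorem Hyperbolic.eq_C_mul_of_roots_eq {P Q : ℝ[X]} (hP : Hyperbolic P) (hQ : Hyperbolic Q)
    (h : P.roots = Q.roots) : ∃ s : ℝ, P = s • Q := by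
  refine ⟨P.leadingCoeff / Q.leadingCoeff, ?_⟩
  have hq := leadingCoeff_ne_zero.2 hQ.1
  calc P = C P.leadingCoeff * (Q.roots.map (X - C ·)).prod := by
        rw [← h]; exact hP.splits.eq_prod_roots
    _ = (P.leadingCoeff / Q.leadingCoeff) • (C Q.leadingCoeff * (Q.roots.map (X - C ·)).prod) := by
        rw [smul_eq_C_mul, ← mul_assoc, ← C_mul, div_mul_cancel₀ _ hq]
    _ = _ := by rw [← hQ.splits.eq_prod_roots]

/-- At a zero in the upper half-plane `P/Q` would be real, so the zeros of `P` and `Q` would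
coincide; the combination would then be a multiple of `Q` vanishing there, hence zero. -/
theorem ZerosInterlace.hyperbolic_add {P Q : ℝ[X]} (hP : Hyperbolic P) (hQ : Hyperbolic Q)
    (h : ZerosInterlace P Q) {a b : ℝ} (h0 : a • P + b • Q ≠ 0) :
    Hyperbolic (a • P + b • Q) := by
  wlog hPQ : Alternates (sortedZeros P) (sortedZeros Q) generalizing P Q a b
  · rw [add_comm] at h0 ⊢
    exact this hQ hP h.symm h0 (h.resolve_left hPQ)
  refine hyperbolic_of_forall_im_pos fun z hz hzero => ?_
  have hQz := hQ.aeval_ne_zero hz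
  simp only [map_add, map_smul, Complex.real_smul] at hzero
  have hs : ∃ s : ℝ, aeval z P = s * aeval z Q := by
    have ha : a ≠ 0 := by
      rintro rfl
      have hb : b = 0 := by simpa [hQz] using hzero
      simp [hb] at h0
    have haC : (a : ℂ) ≠ 0 := by exact_mod_cast ha
    refine ⟨-b / a, ?_⟩
    push_cast
    field_simp
    linear_combination hzero
  have hroots := roots_eq_of_totalArg hPQ hz ((sin_totalArg_sub_eq_zero_iff hP hQ hz).2 hs)
  obtain ⟨s, rfl⟩ := hP.eq_C_mul_of_roots_eq hQ hroots
  rw [map_smul, Complex.real_smul] at hzero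
  have h1 : ((a * s + b : ℝ) : ℂ) * aeval z Q = 0 := by push_cast; linear_combination hzero
  have h2 : a * s + b = 0 := by exact_mod_cast (mul_eq_zero.1 h1).resolve_right hQz
  exact h0 (by rw [smul_smul, ← add_smul, h2, zero_smul])

/-! ### Linear pencils of hyperbolic polynomials have interlacing zeros -/

theorem List.countP_lt_of_getElem_lt {a : List ℝ} (ha : a.Pairwise (· ≤ ·)) {x : ℝ} {i : ℕ}
    (hi : i < a.length) (h : a[i] < x) : a.countP (x < ·) + i < a.length := by
  rw [← List.take_append_drop (i + 1) a, List.countP_append, List.take_append_drop]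
  have h1 : (a.take (i + 1)).countP (x < ·) = 0 := by
    rw [List.countP_eq_zero]
    intro b hb
    obtain ⟨j, hj, rfl⟩ := List.mem_iff_getElem.1 hb
    rw [List.length_take] at hj
    rw [List.getElem_take]
    have hji : a[j] ≤ a[i] := by
      rcases (show j ≤ i by omega).eq_or_lt with rfl | hlt
      · exact le_rfl
      · exact List.pairwise_iff_getElem.1 ha j i (by omega) hi hlt
    simpa using hji.trans h.le
  have h2 : (a.drop (i + 1)).countP (x < ·) ≤ a.length - (i + 1) := by
    simpa using List.countP_le_length (p := fun y => decide (x < y)) (l := a.drop (i + 1))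
  omega

theorem List.le_countP_of_lt_getElem {a : List ℝ} (ha : a.Pairwise (· ≤ ·)) {x : ℝ} {i : ℕ}
    (hi : i < a.length) (h : x < a[i]) : a.length ≤ a.countP (x < ·) + i := by
  have h1 : (a.drop i).countP (x < ·) = (a.drop i).length := by
    rw [List.countP_eq_length]
    intro b hb
    obtain ⟨j, hj, rfl⟩ := List.mem_iff_getElem.1 hb
    rw [List.length_drop] at hj
    rw [List.getElem_drop]
    have hji : a[i] ≤ a[i + j] := by
      rcases (show i ≤ i + j by omega).eq_or_lt with heq | hlt
      · simp [← heq]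
      · exact List.pairwise_iff_getElem.1 ha i (i + j) hi (by omega) hlt
    simpa using h.trans_le hji
  have h2 : (a.drop i).countP (x < ·) ≤ a.countP (x < ·) := (List.drop_sublist i a).countP_le
  rw [h1, List.length_drop] at h2
  omega

/-- A failed inequality of the chain opens a gap between two entries, and a point of the gap outside
both lists has counts that break the bounds. -/
theorem alternates_of_countP {a b : List ℝ} (ha : a.Pairwise (· ≤ ·)) (hb : b.Pairwise (· ≤ ·))
    (h : ∀ x, x ∉ a → x ∉ b → b.countP (x < ·) ≤ a.countP (x < ·) ∧
      a.countP (x < ·) ≤ b.countP (x < ·) + 1) : Alternates a b ∨ Alternates b a := by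
  have hfin : {x | x ∈ a ∨ x ∈ b}.Finite := a.finite_toSet.union b.finite_toSet
  have hbetween : ∀ x y : ℝ, x < y → ∃ z, x < z ∧ z < y ∧ z ∉ a ∧ z ∉ b := by
    intro x y hxy
    obtain ⟨z, hz, hz'⟩ := (Set.Ioo_infinite hxy).exists_notMem_finite hfin
    exact ⟨z, hz.1, hz.2, not_or.1 hz'⟩
  -- To the left of all entries the counts are the lengths.
  obtain ⟨x, hx⟩ := hfin.bddBelow
  have hlen : b.length ≤ a.length ∧ a.length ≤ b.length + 1 := by
    have hxa : ∀ y ∈ a, x - 1 < y := fun y hy => by linarith [hx (Or.inl hy)]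
    have hxb : ∀ y ∈ b, x - 1 < y := fun y hy => by linarith [hx (Or.inr hy)]
    have := h (x - 1) (fun h => (hxa _ h).false) (fun h => (hxb _ h).false)
    rwa [List.countP_eq_length.2 (by simpa using hxb),
      List.countP_eq_length.2 (by simpa using hxa)] at this
  rcases hlen.2.eq_or_lt with hl | hl
  · refine Or.inl ⟨Or.inr hl, fun i hia hib => ?_, fun i hia hib => ?_⟩ <;> by_contra! hlt
    · obtain ⟨z, hz1, hz2, hza, hzb⟩ := hbetween _ _ hlt
      have h1 := List.countP_lt_of_getElem_lt hb hib hz1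
      have h2 := List.le_countP_of_lt_getElem ha hia hz2
      have := h z hza hzb
      omega
    · obtain ⟨z, hz1, hz2, hza, hzb⟩ := hbetween _ _ hlt
      have h1 := List.countP_lt_of_getElem_lt ha hia hz1
      have h2 := List.le_countP_of_lt_getElem hb hib hz2
      have := h z hza hzb
      omega
  -- With equal lengths, `a` having at least as many entries beyond each point means that the chain
  -- starts with `b`.
  · refine Or.inr ⟨Or.inl (by omega), fun i hib hia => ?_, fun i hib hia => ?_⟩ <;> by_contra! hlt
    · obtain ⟨z, hz1, hz2, hza, hzb⟩ := hbetween _ _ hlt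
      have h1 := List.countP_lt_of_getElem_lt ha hia hz1
      have h2 := List.le_countP_of_lt_getElem hb hib hz2
      have := h z hza hzb
      omega
    · obtain ⟨z, hz1, hz2, hza, hzb⟩ := hbetween _ _ hlt
      have h1 := List.countP_lt_of_getElem_lt hb hib hz1
      have h2 := List.le_countP_of_lt_getElem ha hia hz2
      have := h z hza hzb
      omega

theorem continuousOn_totalArg (P : ℝ[X]) : ContinuousOn (totalArg P) {z | 0 < z.im} := by
  unfold totalArg
  refine continuousOn_multiset_sum _ fun a _ => ?_
  unfold upperArg
  refine continuousOn_const.add (Real.continuous_arctan.comp_continuousOn ?_)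
  exact ContinuousOn.div (by fun_prop) (by fun_prop) fun z hz => (ne_of_gt hz)

theorem tendsto_upperArg {x a : ℝ} (h : a ≠ x) :
    Filter.Tendsto (fun ε : ℝ => upperArg (x + ε * Complex.I) a) (nhdsWithin 0 (Set.Ioi 0))
      (nhds (if x < a then Real.pi else 0)) := by
  have him : (fun ε : ℝ => upperArg (x + ε * Complex.I) a) =
      fun ε : ℝ => Real.pi / 2 + Real.arctan ((a - x) * ε⁻¹) := by
    ext ε; simp [upperArg, div_eq_mul_inv]
  rw [him]
  split_ifs with hlt
  · have h1 : Filter.Tendsto (fun ε : ℝ => (a - x) * ε⁻¹) (nhdsWithin 0 (Set.Ioi 0))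
        Filter.atTop := tendsto_inv_nhdsGT_zero.const_mul_atTop (sub_pos.2 hlt)
    have h2 := (Real.tendsto_arctan_atTop.mono_right nhdsWithin_le_nhds).comp h1
    simpa using h2.const_add (Real.pi / 2)
  · have hlt' : a - x < 0 := sub_neg.2 (lt_of_le_of_ne (not_lt.1 hlt) h)
    have h1 : Filter.Tendsto (fun ε : ℝ => (a - x) * ε⁻¹) (nhdsWithin 0 (Set.Ioi 0))
        Filter.atBot := tendsto_inv_nhdsGT_zero.const_mul_atTop_of_neg hlt'
    have h2 := (Real.tendsto_arctan_atBot.mono_right nhdsWithin_le_nhds).comp h1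
    simpa using h2.const_add (Real.pi / 2)

/-- On vertical approach to `x`, each zero to the right of `x` contributes `π` and each zero to the
left contributes `0`: boundary values of the argument count zeros. -/
theorem tendsto_totalArg {P : ℝ[X]} {x : ℝ} (h : x ∉ P.roots) :
    Filter.Tendsto (fun ε : ℝ => totalArg P (x + ε * Complex.I)) (nhdsWithin 0 (Set.Ioi 0))
      (nhds ((P.roots.countP (x < ·) : ℝ) * Real.pi)) := by
  have hsum : ∀ s : Multiset ℝ, (s.map fun a => if x < a then Real.pi else 0).sum =
      (s.countP (x < ·) : ℝ) * Real.pi := by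
    intro s
    induction s using Multiset.induction with
    | empty => simp
    | cons a s ih =>
      by_cases hxa : x < a
      · rw [Multiset.map_cons, Multiset.sum_cons, ih, Multiset.countP_cons_of_pos _ hxa, if_pos hxa]
        push_cast; ring
      · rw [Multiset.map_cons, Multiset.sum_cons, ih, Multiset.countP_cons_of_neg _ hxa, if_neg hxa]
        simp
  rw [← hsum]
  refine tendsto_multiset_sum _ fun a ha => tendsto_upperArg ?_
  rintro rfl
  exact h ha

/-- The argument difference is continuous on the connected upper half-plane and avoids multiples of
`π`, so two of its boundary values differ by at most `π`. A gap of `2π` would force the value `(N -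
1)π` in between. -/
theorem countP_roots_sub_lt {P Q : ℝ[X]}
    (hsin : ∀ z : ℂ, 0 < z.im → Real.sin (totalArg P z - totalArg Q z) ≠ 0) {x y : ℝ}
    (hxP : x ∉ P.roots) (hxQ : x ∉ Q.roots) (hyP : y ∉ P.roots) (hyQ : y ∉ Q.roots) :
    (P.roots.countP (x < ·) : ℤ) - Q.roots.countP (x < ·) <
      P.roots.countP (y < ·) - Q.roots.countP (y < ·) + 2 := by
  by_contra! hge
  set N := (P.roots.countP (x < ·) : ℤ) - Q.roots.countP (x < ·) with hN
  have hx := (tendsto_totalArg hxP).sub (tendsto_totalArg hxQ)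
  have hy := (tendsto_totalArg hyP).sub (tendsto_totalArg hyQ)
  have hπ := Real.pi_pos
  have hNR : (N : ℝ) = (P.roots.countP (x < ·) : ℝ) - Q.roots.countP (x < ·) := by
    rw [hN]; push_cast; rfl
  have hgeR : (P.roots.countP (y < ·) : ℝ) - Q.roots.countP (y < ·) + 2 ≤ N := by
    exact_mod_cast hge
  rw [← sub_mul, ← hNR] at hx
  rw [← sub_mul] at hy
  have hx' := hx.eventually_const_lt (u := ((N - 1 : ℤ) : ℝ) * Real.pi) (by
    push_cast; nlinarith)
  have hy' := hy.eventually_lt_const (u := ((N - 1 : ℤ) : ℝ) * Real.pi) (by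
    push_cast; nlinarith)
  obtain ⟨ε, h1, hε⟩ := (hx'.and self_mem_nhdsWithin).exists
  obtain ⟨δ, h2, hδ⟩ := (hy'.and self_mem_nhdsWithin).exists
  have hconn : IsPreconnected {z : ℂ | 0 < z.im} := (convex_halfSpace_im_gt 0).isPreconnected
  obtain ⟨z, hz, hz'⟩ := hconn.intermediate_value (a := (y + δ * Complex.I : ℂ))
    (b := (x + ε * Complex.I : ℂ)) (by simpa using hδ) (by simpa using hε)
    ((continuousOn_totalArg P).sub (continuousOn_totalArg Q)) ⟨h2.le, h1.le⟩
  refine hsin z hz ?_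
  change Real.sin ((totalArg P - totalArg Q) z) = 0
  rw [hz']
  exact Real.sin_int_mul_pi _

/-- Obreschkoff's theorem. -/
theorem zerosInterlace_of_hyperbolic {P Q : ℝ[X]} (hP : Hyperbolic P) (hQ : Hyperbolic Q)
    (h : ∀ s : ℝ, Hyperbolic (P + s • Q)) : ZerosInterlace P Q := by
  have hsin : ∀ z : ℂ, 0 < z.im → Real.sin (totalArg P z - totalArg Q z) ≠ 0 := by
    intro z hz h0
    obtain ⟨s, hs⟩ := (sin_totalArg_sub_eq_zero_iff hP hQ hz).1 h0
    refine (h (-s)).aeval_ne_zero hz ?_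
    simp [hs]
  have hcount : ∀ (R : ℝ[X]) (x : ℝ),
      (sortedZeros R).countP (x < ·) = R.roots.countP (x < ·) := by
    intro R x
    rw [← Multiset.coe_countP, sortedZeros, Multiset.sort_eq]
  have hmem : ∀ (R : ℝ[X]) (x : ℝ), x ∈ sortedZeros R ↔ x ∈ R.roots := by
    intro R x; simp [sortedZeros]
  have hsort : ∀ R : ℝ[X], (sortedZeros R).Pairwise (· ≤ ·) := fun R => Multiset.pairwise_sort _ _
  -- The point `y + 1` lies to the right of all zeros, so both counts vanish there.
  obtain ⟨y, hy⟩ := (P.roots.toFinset ∪ Q.roots.toFinset).bddAbove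
  have hyP : ∀ a ∈ P.roots, a < y + 1 := fun a ha => by
    have := hy (show a ∈ ((P.roots.toFinset ∪ Q.roots.toFinset : Finset ℝ) : Set ℝ) by
      simp [-mem_roots', ha])
    linarith
  have hyQ : ∀ a ∈ Q.roots, a < y + 1 := fun a ha => by
    have := hy (show a ∈ ((P.roots.toFinset ∪ Q.roots.toFinset : Finset ℝ) : Set ℝ) by
      simp [-mem_roots', ha])
    linarith
  have hyP0 : P.roots.countP (y + 1 < ·) = 0 :=
    Multiset.countP_eq_zero.2 fun a ha => (hyP a ha).not_gt
  have hyQ0 : Q.roots.countP (y + 1 < ·) = 0 :=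
    Multiset.countP_eq_zero.2 fun a ha => (hyQ a ha).not_gt
  have hyP1 : y + 1 ∉ P.roots := fun h => (hyP _ h).false
  have hyQ1 : y + 1 ∉ Q.roots := fun h => (hyQ _ h).false
  -- Any two values of the count difference are within `1` of each other, and `0` is attained at `y
  -- + 1`. So it cannot take both signs, and its sign decides which list starts the chain.
  by_cases hneg : ∃ x, x ∉ P.roots ∧ x ∉ Q.roots ∧
      P.roots.countP (x < ·) < Q.roots.countP (x < ·)
  · obtain ⟨x, hxP, hxQ, hx⟩ := hneg
    refine Or.symm (alternates_of_countP (hsort Q) (hsort P) fun t htQ htP => ?_)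
    rw [hmem] at htP htQ
    rw [hcount, hcount]
    have h1 := countP_roots_sub_lt hsin htP htQ hxP hxQ
    have h2 := countP_roots_sub_lt hsin hyP1 hyQ1 htP htQ
    omega
  · push Not at hneg
    refine alternates_of_countP (hsort P) (hsort Q) fun t htP htQ => ?_
    rw [hmem] at htP htQ
    rw [hcount, hcount]
    have h1 := countP_roots_sub_lt hsin htP htQ hyP1 hyQ1
    have h2 := hneg t htP htQ
    omega

/-! ### Hyperbolic polynomials whose small perturbations are hyperbolic -/

theorem hyperbolic_of_splits {p : ℝ[X]} (hp : p.Splits) (h0 : p ≠ 0) : Hyperbolic p := by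
  refine ⟨h0, fun z hz => ?_⟩
  obtain ⟨x, rfl⟩ := hp.mem_range_of_isRoot (S := ℂ) h0 (x := z)
    (by rwa [IsRoot.def, eval_map_algebraMap])
  simp

/-- A real polynomial with at most one zero fewer than its degree allows is hyperbolic. -/
theorem hyperbolic_of_card_le {p : ℝ[X]} (h0 : p ≠ 0) {S : Finset ℝ}
    (hS : ∀ x ∈ S, p.IsRoot x) (hcard : p.natDegree ≤ S.card + 1) : Hyperbolic p := by
  obtain ⟨q, hq, hdeg, hroots⟩ := exists_prod_multiset_X_sub_C_mul p
  have hSr : S.card ≤ p.roots.card := by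
    refine (Finset.card_le_card fun x hx => ?_).trans p.roots.toFinset_card_le
    simpa [h0] using hS x hx
  have hq1 : q.Splits := Splits.of_natDegree_le_one (by omega)
  refine hyperbolic_of_splits (hq ▸ Splits.mul (Splits.multisetProd fun f hf => ?_) hq1) h0
  obtain ⟨a, -, rfl⟩ := Multiset.mem_map.1 hf
  exact Splits.X_sub_C a

/-- Small perturbations within degree at most `n` are hyperbolic. -/
def StablyHyperbolic (n : ℕ) (f : ℝ[X]) : Prop :=
  ∀ g : ℝ[X], g.natDegree ≤ n → ∀ᶠ ε in nhds (0 : ℝ), Hyperbolic (f + ε • g)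

/-- With `f = (X - x)q` and `q(x) ≠ 0`, the product `f(x - δ)f(x + δ)` is `-δ²` times a positive
number for small `δ`. -/
theorem exists_sign_change {f : ℝ[X]} (h0 : f ≠ 0) {x : ℝ} (hx : f.rootMultiplicity x = 1)
    {U : Set ℝ} (hU : U ∈ nhds x) :
    ∃ a b : ℝ, a ≤ b ∧ Set.Icc a b ⊆ U ∧ f.eval a * f.eval b < 0 := by
  obtain ⟨q, hq, hqx⟩ := exists_eq_pow_rootMultiplicity_mul_and_not_dvd f h0 x
  rw [hx, pow_one] at hq
  rw [dvd_iff_isRoot, IsRoot.def] at hqx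
  have hcont : Filter.Tendsto (fun δ : ℝ => q.eval (x - δ) * q.eval (x + δ)) (nhds 0)
      (nhds (q.eval x * q.eval x)) := by
    have : Continuous fun δ : ℝ => q.eval (x - δ) * q.eval (x + δ) := by fun_prop
    simpa using this.tendsto 0
  have h1 := hcont.eventually_const_lt (mul_self_pos.2 hqx)
  obtain ⟨η, hη, hball⟩ := Metric.mem_nhds_iff.1 hU
  have h2 : ∀ᶠ δ : ℝ in nhds 0, δ < η := gt_mem_nhds hη
  obtain ⟨δ, ⟨h3, h4⟩, hδ⟩ := (((h1.and h2).filter_mono nhdsWithin_le_nhds).and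
    (self_mem_nhdsWithin : Set.Ioi (0 : ℝ) ∈ nhdsWithin 0 (Set.Ioi 0))).exists
  have hδ : 0 < δ := hδ
  refine ⟨x - δ, x + δ, by linarith, fun y hy => hball ?_, ?_⟩
  · rw [Metric.mem_ball, Real.dist_eq, abs_lt]
    exact ⟨by linarith [hy.1], by linarith [hy.2]⟩
  · rw [hq]
    simp only [eval_mul, eval_sub, eval_X, eval_C]
    nlinarith [mul_pos (mul_pos hδ hδ) h3]

/-- Sign changes at the simple zeros survive small perturbations, in disjoint neighbourhoods. This
accounts for all zeros but at most one, the degree bound being `n ≤ deg f + 1`, and a single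
leftover zero of a real polynomial is real. -/
theorem Hyperbolic.stablyHyperbolic {f : ℝ[X]} {n : ℕ} (hf : Hyperbolic f)
    (hdeg : f.natDegree ≤ n) (hdeg' : n ≤ f.natDegree + 1) (hnodup : f.roots.Nodup) :
    StablyHyperbolic n f := by
  intro g hg
  set S := f.roots.toFinset with hS
  have hcardS : S.card = f.natDegree := by
    rw [hS, Multiset.toFinset_card_of_nodup hnodup, ← hf.splits.natDegree_eq_card_roots]
  obtain ⟨U, hU, hdisj⟩ := S.finite_toSet.t2_separation
  have hsign : ∀ x ∈ S, ∃ a b : ℝ, a ≤ b ∧ Set.Icc a b ⊆ U x ∧ f.eval a * f.eval b < 0 := by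
    intro x hx
    refine exists_sign_change hf.1 ?_ ((hU x).2.mem_nhds (hU x).1)
    rw [← count_roots]
    exact Multiset.count_eq_one_of_mem hnodup (by simpa [hS] using hx)
  choose! a b hab hIcc hlt using hsign
  have h1 : ∀ᶠ ε in nhds (0 : ℝ), ∀ x ∈ S,
      (f + ε • g).eval (a x) * (f + ε • g).eval (b x) < 0 := by
    rw [Filter.eventually_all_finset]
    intro x hx
    have hcont : Continuous fun ε : ℝ =>
        (f + ε • g).eval (a x) * (f + ε • g).eval (b x) := by
      simp only [eval_add, eval_smul, smul_eq_mul]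
      fun_prop
    exact (hcont.tendsto 0).eventually_lt_const (by simpa using hlt x hx)
  -- This only ensures that the perturbed polynomial is non-zero.
  have h2 : ∀ᶠ ε in nhds (0 : ℝ), (f + ε • g).coeff f.natDegree ≠ 0 := by
    have hcont : Continuous fun ε : ℝ => (f + ε • g).coeff f.natDegree := by
      simp only [coeff_add, coeff_smul, smul_eq_mul]
      fun_prop
    exact (hcont.tendsto 0).eventually_ne (by simpa using hf.1)
  filter_upwards [h1, h2] with ε hε hε'
  have hroot : ∀ x ∈ S, ∃ y ∈ Set.Icc (a x) (b x), (f + ε • g).IsRoot y := by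
    intro x hx
    have hc : ContinuousOn (fun y => (f + ε • g).eval y) (Set.Icc (a x) (b x)) :=
      (f + ε • g).continuous.continuousOn
    rcases mul_neg_iff.1 (hε x hx) with h | h
    · exact intermediate_value_Icc' (hab x hx) hc ⟨h.2.le, h.1.le⟩
    · exact intermediate_value_Icc (hab x hx) hc ⟨h.1.le, h.2.le⟩
  choose! y hy hyroot using hroot
  have hinj : Set.InjOn y S := by
    intro x hx x' hx' hxx'
    by_contra hne
    refine Set.disjoint_left.1 (hdisj hx hx' hne) (hIcc x hx (hy x hx)) ?_
    rw [hxx']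
    exact hIcc x' hx' (hy x' hx')
  refine hyperbolic_of_card_le (S := S.image y) (fun h => hε' (by rw [h, coeff_zero])) ?_ ?_
  · intro z hz
    obtain ⟨x, hx, rfl⟩ := Finset.mem_image.1 hz
    exact hyroot x hx
  · rw [Finset.card_image_of_injOn hinj, hcardS]
    refine le_trans (natDegree_add_le_of_degree_le hdeg ?_) hdeg'
    exact (natDegree_smul_le _ _).trans hg

open ComplexConjugate in
/-- Twice the real part of `u * (z + w) ^ n`, as a polynomial in the real variable `z`. -/
theorem exists_stablyHyperbolic {n : ℕ} (hn : 0 < n) {u w : ℂ} (hu : u ≠ 0) (hw : 0 < w.im) :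
    ∃ f : ℝ[X], toComplex f = C u * (X + C w) ^ n + C (conj u) * (X + C (conj w)) ^ n ∧
      f.natDegree ≤ n ∧ StablyHyperbolic n f := by
  have hreal : ∀ k, ((C u * (X + C w) ^ n + C (conj u) * (X + C (conj w)) ^ n).coeff k).im = 0 := by
    intro k
    have : (C u * (X + C w) ^ n + C (conj u) * (X + C (conj w)) ^ n).coeff k =
        u * (w ^ (n - k) * n.choose k) + conj (u * (w ^ (n - k) * n.choose k)) := by
      simp [coeff_X_add_C_pow]
    rw [this, Complex.add_conj]
    exact Complex.ofReal_im _
  obtain ⟨f, hf⟩ := exists_toComplex_eq hreal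
  have hcu : conj u ≠ 0 := (_root_.map_ne_zero _).2 hu
  have heval : ∀ z : ℂ, aeval z f = u * (z + w) ^ n + conj u * (z + conj w) ^ n := by
    intro z
    rw [← eval_toComplex, hf]; simp
  have hcoeff : ∀ k, ((f.coeff k : ℝ) : ℂ) =
      u * (w ^ (n - k) * n.choose k) + conj u * ((conj w) ^ (n - k) * n.choose k) := by
    intro k
    rw [← toComplex_coeff, hf]; simp [coeff_X_add_C_pow]
  have hwne : w ≠ conj w := by
    intro h
    have := congrArg Complex.im h
    simp at this; linarith
  -- The two top coefficients are `u + ū` and `n(uw + ūw̄)`; if both vanished, so would `u(w - w̄)`.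
  have hdeg' : n ≤ f.natDegree + 1 := by
    by_contra! hlt
    have h1 := hcoeff n
    have h2 := hcoeff (n - 1)
    rw [coeff_eq_zero_of_natDegree_lt (by omega)] at h1 h2
    have h3 : n - (n - 1) = 1 := by omega
    have h4 : n.choose (n - 1) = n := by
      rw [← Nat.choose_symm (by omega), h3, Nat.choose_one_right]
    simp [h3, h4] at h1 h2
    have hnC : (n : ℂ) ≠ 0 := by exact_mod_cast hn.ne'
    have h5 : (u * (w - conj w)) * n = 0 := by linear_combination h1 * conj w * n - h2
    rcases mul_eq_zero.1 h5 with h | h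
    · exact (mul_ne_zero hu (sub_ne_zero.2 hwne)) h
    · exact hnC h
  have hf0 : f ≠ 0 := by
    rintro rfl
    have h1 := heval (-w)
    simp [hn.ne', hu] at h1
    exact hwne (by linear_combination -h1)
  have hdeg : f.natDegree ≤ n := by
    rw [natDegree_le_iff_coeff_eq_zero]
    intro k hk
    have := hcoeff k
    rw [Nat.choose_eq_zero_of_lt hk] at this
    simpa using this
  have hhyp : Hyperbolic f := by
    refine ⟨hf0, fun z hz => ?_⟩
    rw [heval] at hz
    -- A zero is equidistant from `-w` and `-w̄`, hence real.
    have h1 : ‖z + w‖ ^ n = ‖z + conj w‖ ^ n := by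
      have := congrArg norm (eq_neg_of_add_eq_zero_left hz)
      rw [norm_neg, norm_mul, norm_mul, RCLike.norm_conj, norm_pow, norm_pow] at this
      exact mul_left_cancel₀ (norm_ne_zero_iff.2 hu) this
    have h2 := (pow_left_inj₀ (norm_nonneg _) (norm_nonneg _) hn.ne').1 h1
    have h3 := congrArg (· ^ 2) h2
    simp only [Complex.sq_norm, Complex.normSq_apply] at h3
    simp at h3
    have h4 : z.im * w.im = 0 := by linarith
    exact (mul_eq_zero.1 h4).resolve_right hw.ne'
  refine ⟨f, hf, hdeg, hhyp.stablyHyperbolic hdeg hdeg' ?_⟩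
  rw [Multiset.nodup_iff_count_le_one]
  intro t
  rw [count_roots]
  by_contra! hlt
  obtain ⟨h1, h2⟩ := (one_lt_rootMultiplicity_iff_isRoot hf0).1 hlt
  have h1' : aeval (t : ℂ) f = 0 := by
    rw [show ((t : ℝ) : ℂ) = algebraMap ℝ ℂ t from rfl, aeval_algebraMap_apply]
    simpa using h1
  have h2' : eval (t : ℂ) (derivative (toComplex f)) = 0 := by
    rw [toComplex, derivative_map, eval_map_algebraMap,
      show ((t : ℝ) : ℂ) = algebraMap ℝ ℂ t from rfl, aeval_algebraMap_apply]
    simpa using h2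
  rw [heval] at h1'
  rw [hf] at h2'
  simp [derivative_X_add_C_pow] at h2'
  obtain ⟨m, rfl⟩ : ∃ m, n = m + 1 := ⟨n - 1, by omega⟩
  rw [Nat.add_sub_cancel] at h2'
  have hmC : ((m + 1 : ℕ) : ℂ) ≠ 0 := by exact_mod_cast hn.ne'
  -- At a double zero the derivative gives the same relation with exponent `n - 1`; eliminating the
  -- conjugate term leaves `u(w - w̄)(t + w)^m = 0`.
  have h3 : u * (t + w) ^ m + conj u * (t + conj w) ^ m = 0 := by
    refine (mul_eq_zero.1 ?_).resolve_left hmC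
    push_cast at h2' ⊢
    linear_combination h2'
  have h4 : (u * (w - conj w)) * (t + w) ^ m = 0 := by
    linear_combination h1' - (t + conj w) * h3
  have h5 : (t : ℂ) + w ≠ 0 := by
    intro h
    have := congrArg Complex.im h
    simp at this; linarith
  exact (mul_ne_zero (mul_ne_zero hu (sub_ne_zero.2 hwne)) (pow_ne_zero _ h5)) h4

/-! ### Complex multiples of real polynomials -/

theorem RealRooted.exists_eq_smul {p : ℂ[X]} (h : RealRooted p ∨ p = 0) :
    ∃ (b : ℂ) (s : ℝ[X]), p = b • toComplex s := by
  rcases h with h | rfl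
  · obtain ⟨b, s, -, -, h⟩ := h.exists_smul_toComplex
    exact ⟨b, s, h⟩
  · exact ⟨0, 0, by simp⟩

/-- A multiple of a real polynomial has all coefficients on one real line through `0`, so `Im(p_i
p̄_j) = 0` for all `i`, `j`. After division by `ε` this is affine in `ε`, and the two values `ε`,
`2ε` separate its terms: coefficients of `h` are pairwise parallel, and `Im h` is proportional to
`r`. -/
theorem real_or_parallel {r : ℝ[X]} (hr : r ≠ 0) {h : ℂ[X]}
    (H : ∀ᶠ ε : ℝ in nhds 0, ∃ (b : ℂ) (s : ℝ[X]), toComplex r + (ε : ℂ) • h = b • toComplex s) :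
    (∃ l : ℂ, h = l • toComplex r) ∨ ∃ s : ℝ[X], h = toComplex s := by
  have H2 : ∀ᶠ ε : ℝ in nhds 0, ∃ (b : ℂ) (s : ℝ[X]),
      toComplex r + ((2 * ε : ℝ) : ℂ) • h = b • toComplex s := by
    have : Filter.Tendsto (fun ε : ℝ => 2 * ε) (nhds 0) (nhds 0) := by
      have h : Continuous fun ε : ℝ => 2 * ε := by fun_prop
      simpa using h.tendsto 0
    exact this.eventually H
  obtain ⟨ε, ⟨h1, h2⟩, hε⟩ := (((H.and H2).filter_mono nhdsWithin_le_nhds).and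
    (self_mem_nhdsWithin : Set.Ioi (0 : ℝ) ∈ nhdsWithin 0 (Set.Ioi 0))).exists
  have hε : 0 < ε := hε
  have key : ∀ ε : ℝ, 0 < ε →
      (∃ (b : ℂ) (s : ℝ[X]), toComplex r + (ε : ℂ) • h = b • toComplex s) → ∀ i j,
      (h.coeff i).im * r.coeff j - r.coeff i * (h.coeff j).im +
        ε * ((h.coeff i).im * (h.coeff j).re - (h.coeff i).re * (h.coeff j).im) = 0 := by
    rintro ε hε ⟨b, s, hs⟩ i j
    have hi := congrArg (fun p => p.coeff i) hs
    have hj := congrArg (fun p => p.coeff j) hs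
    simp only [coeff_add, coeff_smul, toComplex_coeff, smul_eq_mul] at hi hj
    have hi1 := congrArg Complex.re hi
    have hi2 := congrArg Complex.im hi
    have hj1 := congrArg Complex.re hj
    have hj2 := congrArg Complex.im hj
    simp at hi1 hi2 hj1 hj2
    refine (mul_eq_zero.1 ?_).resolve_left hε.ne'
    linear_combination (r.coeff j + ε * (h.coeff j).re) * hi2 + b.im * s.coeff i * hj1 -
      (r.coeff i + ε * (h.coeff i).re) * hj2 - b.im * s.coeff j * hi1
  have e1 : ∀ i j, (h.coeff i).im * (h.coeff j).re = (h.coeff i).re * (h.coeff j).im := by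
    intro i j
    have k1 := key ε hε h1 i j
    have k2 := key (2 * ε) (by positivity) h2 i j
    have : ε * ((h.coeff i).im * (h.coeff j).re - (h.coeff i).re * (h.coeff j).im) = 0 := by
      linarith
    linarith [(mul_eq_zero.1 this).resolve_left hε.ne']
  have e2 : ∀ i j, (h.coeff i).im * r.coeff j = r.coeff i * (h.coeff j).im := by
    intro i j
    have k1 := key ε hε h1 i j
    rw [e1 i j, sub_self, mul_zero, add_zero] at k1
    linarith
  by_cases hy : ∀ i, (h.coeff i).im = 0
  · obtain ⟨s, hs⟩ := exists_toComplex_eq hy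
    exact Or.inr ⟨s, hs.symm⟩
  · left
    push Not at hy
    obtain ⟨m, hm⟩ := hy
    have hrm : r.coeff m ≠ 0 := by
      intro h0
      refine hr (Polynomial.ext fun i => ?_)
      have := e2 m i
      rw [h0, zero_mul] at this
      simpa [hm] using this
    refine ⟨h.coeff m / r.coeff m, Polynomial.ext fun i => ?_⟩
    rw [coeff_smul, toComplex_coeff, smul_eq_mul]
    have hrmC : (r.coeff m : ℂ) ≠ 0 := by exact_mod_cast hrm
    rw [div_mul_eq_mul_div, eq_div_iff hrmC]
    apply Complex.ext
    · simp
      have a1 := e1 m i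
      have a2 := e2 m i
      refine mul_left_cancel₀ hm ?_
      linear_combination r.coeff m * a1 - (h.coeff m).re * a2
    · simp
      linarith [e2 m i]

/-! ### Operators preserving real-rootedness -/

/-- The alternative holds for each `g` separately; it is uniform because a vector space is not the
union of two proper subspaces. -/
theorem real_or_parallel_range {L : ℂ[X] →ₗ[ℂ] ℂ[X]} {n : ℕ} {c : ℂ} (hc : c ≠ 0) {r : ℝ[X]}
    (hr : r ≠ 0)
    (H : ∀ g : ℝ[X], g.natDegree ≤ n → ∀ᶠ ε : ℝ in nhds 0,
      RealRooted (c • toComplex r + (ε : ℂ) • L (toComplex g)) ∨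
        c • toComplex r + (ε : ℂ) • L (toComplex g) = 0) :
    (∀ g : ℝ[X], g.natDegree ≤ n → ∃ l : ℂ, L (toComplex g) = l • toComplex r) ∨
      ∀ g : ℝ[X], g.natDegree ≤ n → ∃ s : ℝ[X], L (toComplex g) = c • toComplex s := by
  have key : ∀ g : ℝ[X], g.natDegree ≤ n → (∃ l : ℂ, L (toComplex g) = l • toComplex r) ∨
      ∃ s : ℝ[X], L (toComplex g) = c • toComplex s := by
    intro g hg
    have h1 : ∀ᶠ ε : ℝ in nhds 0, ∃ (b : ℂ) (s : ℝ[X]),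
        toComplex r + (ε : ℂ) • (c⁻¹ • L (toComplex g)) = b • toComplex s := by
      filter_upwards [H g hg] with ε hε
      obtain ⟨b, s, hs⟩ := RealRooted.exists_eq_smul hε
      refine ⟨c⁻¹ * b, s, ?_⟩
      rw [← smul_smul, ← hs, smul_add, smul_smul c⁻¹ c, inv_mul_cancel₀ hc, one_smul,
        smul_comm c⁻¹]
    rcases real_or_parallel hr h1 with ⟨l, hl⟩ | ⟨s, hs⟩
    · exact Or.inl ⟨c * l, by rw [← smul_smul, ← hl, smul_inv_smul₀ hc]⟩
    · exact Or.inr ⟨s, by rw [← hs, smul_inv_smul₀ hc]⟩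
  by_contra! hcon
  obtain ⟨⟨g₁, hg₁, h₁⟩, g₂, hg₂, h₂⟩ := hcon
  obtain ⟨s, hs⟩ := (key g₁ hg₁).resolve_left fun ⟨l, hl⟩ => h₁ l hl
  obtain ⟨l, hl⟩ := (key g₂ hg₂).resolve_right fun ⟨s, hs⟩ => h₂ s hs
  rcases key (g₁ + g₂) (natDegree_add_le_of_degree_le hg₁ hg₂) with ⟨l', hl'⟩ | ⟨s', hs'⟩
  · refine h₁ (l' - l) ?_
    rw [toComplex_add, map_add, hl] at hl'
    rw [sub_smul, ← hl', add_sub_cancel_right]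
  · refine h₂ (s' - s) ?_
    rw [toComplex_add, map_add, hs] at hs'
    have : toComplex (s' - s) = toComplex s' - toComplex s := by
      ext k; simp
    rw [this, smul_sub, ← hs', add_sub_cancel_left]

/-- The linear operator maps the real polynomials of degree at most `n` into the complex multiples
of one hyperbolic polynomial. -/
def HasParallelRange (L : ℂ[X] →ₗ[ℂ] ℂ[X]) (n : ℕ) : Prop :=
  ∃ P : ℝ[X], Hyperbolic P ∧ ∀ g : ℝ[X], g.natDegree ≤ n → ∃ l : ℂ, L (toComplex g) = l • toComplex P

/-- The linear operator maps the real polynomials of degree at most `n`, up to a common factor, into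
the real span of two hyperbolic polynomials with interlacing zeros. -/
def HasInterlacingRange (L : ℂ[X] →ₗ[ℂ] ℂ[X]) (n : ℕ) : Prop :=
  ∃ (c : ℂ) (P Q : ℝ[X]), Hyperbolic P ∧ Hyperbolic Q ∧ ZerosInterlace P Q ∧
    ∀ g : ℝ[X], g.natDegree ≤ n →
      ∃ a b : ℝ, L (toComplex g) = c • (a • toComplex P + b • toComplex Q)

theorem hyperbolic_or_zero {c : ℂ} (hc : c ≠ 0) {s : ℝ[X]}
    (h : RealRooted (c • toComplex s) ∨ c • toComplex s = 0) : Hyperbolic s ∨ s = 0 :=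
  h.imp RealRooted.of_smul_toComplex fun h => by simpa [hc] using h

theorem exists_real_combination {p q r : ℂ} (h : (p * starRingEnd ℂ q).im ≠ 0) :
    ∃ a b : ℝ, r = a * p + b * q := by
  have h' : p.im * q.re - p.re * q.im ≠ 0 := by
    intro h0
    apply h
    simp; linarith
  refine ⟨(r.im * q.re - r.re * q.im) / (p.im * q.re - p.re * q.im),
    (p.im * r.re - p.re * r.im) / (p.im * q.re - p.re * q.im), ?_⟩
  apply Complex.ext
  · simp only [Complex.add_re, Complex.re_ofReal_mul]
    rw [div_mul_eq_mul_div, div_mul_eq_mul_div, ← add_div, eq_div_iff h']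
    ring
  · simp only [Complex.add_im, Complex.im_ofReal_mul]
    rw [div_mul_eq_mul_div, div_mul_eq_mul_div, ← add_div, eq_div_iff h']
    ring

/-- After removal of a common factor the images are real polynomials, each hyperbolic or zero, so
evaluation at `i` is injective on them and their real span has dimension at most two. Two
independent images form a hyperbolic pencil and interlace by Obreschkoff's theorem. -/
theorem parallel_or_interlacing_range {L : ℂ[X] →ₗ[ℂ] ℂ[X]} {n : ℕ}
    (H : ∀ g : ℝ[X], g.natDegree ≤ n → RealRooted (L (toComplex g)) ∨ L (toComplex g) = 0) :
    HasParallelRange L n ∨ HasInterlacingRange L n := by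
  by_cases hzero : ∀ g : ℝ[X], g.natDegree ≤ n → L (toComplex g) = 0
  · refine Or.inl ⟨1, ⟨one_ne_zero, fun z hz => by simp at hz⟩, fun g hg => ⟨0, ?_⟩⟩
    rw [hzero g hg, zero_smul]
  push Not at hzero
  obtain ⟨g₁, hg₁, h₁⟩ := hzero
  obtain ⟨c, r, hc, hr, hL₁⟩ := ((H g₁ hg₁).resolve_right h₁).exists_smul_toComplex
  have hadd : ∀ (g₁ g₂ : ℝ[X]) (t : ℝ), g₁.natDegree ≤ n → g₂.natDegree ≤ n →
      (g₁ + t • g₂).natDegree ≤ n := fun g₁ g₂ t h₁ h₂ =>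
    natDegree_add_le_of_degree_le h₁ ((natDegree_smul_le _ _).trans h₂)
  have hdich := real_or_parallel_range (L := L) (n := n) hc hr.1 fun g hg =>
    Filter.Eventually.of_forall fun ε => by
      have := H (g₁ + ε • g) (hadd _ _ _ hg₁ hg)
      rwa [toComplex_add, toComplex_smul, map_add, map_smul, hL₁] at this
  rcases hdich with hpar | hreal
  · exact Or.inl ⟨r, hr, hpar⟩
  by_cases hpar : ∀ g : ℝ[X], g.natDegree ≤ n → ∃ l : ℂ, L (toComplex g) = l • toComplex r
  · exact Or.inl ⟨r, hr, hpar⟩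
  right
  push Not at hpar
  obtain ⟨g₂, hg₂, hL₂⟩ := hpar
  obtain ⟨s, hs⟩ := hreal g₂ hg₂
  have hns : ∀ t : ℝ, s ≠ t • r := by
    rintro t rfl
    exact hL₂ (c * t) (by rw [hs, toComplex_smul, smul_smul])
  have hLadd : ∀ t : ℝ, L (toComplex (g₁ + t • g₂)) = c • toComplex (r + t • s) := by
    intro t
    rw [toComplex_add, toComplex_smul, map_add, map_smul, hL₁, hs, toComplex_add, toComplex_smul,
      smul_add, smul_comm c]
  have hrs : ∀ t : ℝ, Hyperbolic (r + t • s) := by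
    intro t
    refine (hyperbolic_or_zero hc (hLadd t ▸ H _ (hadd _ _ t hg₁ hg₂))).resolve_right fun h0 => ?_
    have ht : t ≠ 0 := by
      rintro rfl
      exact hr.1 (by simpa using h0)
    refine hns (-t⁻¹) ?_
    have : r = -(t • s) := eq_neg_of_add_eq_zero_left h0
    rw [this, smul_neg, neg_smul, neg_neg, smul_smul, inv_mul_cancel₀ ht, one_smul]
  have hshyp : Hyperbolic s := (hyperbolic_or_zero hc (hs ▸ H g₂ hg₂)).resolve_right fun h0 =>
    hns 0 (by simpa using h0)
  refine ⟨c, r, s, hr, hshyp, zerosInterlace_of_hyperbolic hr hshyp hrs, fun g hg => ?_⟩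
  obtain ⟨q, hq⟩ := hreal g hg
  have hI : 0 < Complex.I.im := by simp
  have hsI := hshyp.aeval_ne_zero hI
  -- If `r(i)/s(i)` were real, some `r + ts` would vanish at `i`.
  have hdet : (aeval Complex.I r * starRingEnd ℂ (aeval Complex.I s)).im ≠ 0 := by
    intro h0
    have hreal : aeval Complex.I r * starRingEnd ℂ (aeval Complex.I s) =
        ((aeval Complex.I r * starRingEnd ℂ (aeval Complex.I s)).re : ℂ) :=
      Complex.ext rfl (by simpa using h0)
    set k := (aeval Complex.I r * starRingEnd ℂ (aeval Complex.I s)).re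
    have hn : ((Complex.normSq (aeval Complex.I s) : ℝ) : ℂ) ≠ 0 := by
      exact_mod_cast (Complex.normSq_pos.2 hsI).ne'
    refine (hrs (-(k / Complex.normSq (aeval Complex.I s)))).aeval_ne_zero hI ?_
    rw [map_add, map_smul, Complex.real_smul]
    push_cast
    have h1 : aeval Complex.I s * starRingEnd ℂ (aeval Complex.I s) =
      (Complex.normSq (aeval Complex.I s) : ℂ) := Complex.mul_conj _
    have hcs : starRingEnd ℂ (aeval Complex.I s) ≠ 0 := (_root_.map_ne_zero _).2 hsI
    refine (mul_eq_zero.1 ?_).resolve_right hcs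
    field_simp
    linear_combination (Complex.normSq (aeval Complex.I s) : ℂ) * hreal - k * h1
  obtain ⟨a, b, hab⟩ := exists_real_combination (r := aeval Complex.I q) hdet
  refine ⟨a, b, ?_⟩
  have hzero : q + (-a) • r + (-b) • s = 0 := by
    have hL : L (toComplex (g + (-a) • g₁ + (-b) • g₂)) =
        c • toComplex (q + (-a) • r + (-b) • s) := by
      simp only [toComplex_add, toComplex_smul, map_add, map_smul, hL₁, hs, hq, smul_add,
        smul_comm c]
    have := H (g + (-a) • g₁ + (-b) • g₂) (hadd _ _ _ (hadd _ _ _ hg hg₁) hg₂)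
    rw [hL] at this
    refine (hyperbolic_or_zero hc this).resolve_left fun hh => hh.aeval_ne_zero hI ?_
    simp only [map_add, map_smul, Complex.real_smul]
    push_cast
    linear_combination hab
  have hqe : q = a • r + b • s := by
    rw [neg_smul, neg_smul] at hzero
    calc q = (q + -(a • r) + -(b • s)) + (a • r + b • s) := by abel
      _ = _ := by rw [hzero, zero_add]
  rw [hq, hqe, toComplex_add, toComplex_smul, toComplex_smul]
  rfl

open ComplexConjugate in
-- Equal moduli of `A` and `B` allow a unit `u` with `u² = -B/A`, so `uA + ūB = 0`: the image of the
-- real polynomial `2 Re(u(x + w)^n)` would vanish at the non-real point `z`.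
theorem norm_eval_ne_norm_eval_conj {L : ℂ[X] →ₗ[ℂ] ℂ[X]} {n : ℕ} (hn : 0 < n)
    (H : ∀ f : ℝ[X], f.natDegree ≤ n → StablyHyperbolic n f → RealRooted (L (toComplex f)))
    {z w : ℂ} (hz : 0 < z.im) (hw : 0 < w.im) :
    ‖(L ((X + C w) ^ n)).eval z‖ ≠ ‖(L ((X + C (conj w)) ^ n)).eval z‖ := by
  intro hnorm
  set A := (L ((X + C w) ^ n)).eval z with hA
  set B := (L ((X + C (conj w)) ^ n)).eval z with hB
  obtain ⟨u, hu, huAB⟩ : ∃ u : ℂ, ‖u‖ = 1 ∧ u * A + conj u * B = 0 := by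
    by_cases hA0 : A = 0
    · have hB0 : B = 0 := by rw [← norm_eq_zero, ← hnorm, hA0, norm_zero]
      exact ⟨1, by simp, by simp [hA0, hB0]⟩
    · obtain ⟨u, hu⟩ := IsAlgClosed.exists_pow_nat_eq (-B / A) (n := 2) (by norm_num)
      have hu1 : ‖u‖ = 1 := by
        have := congrArg norm hu
        rw [norm_pow, norm_div, norm_neg, ← hnorm, div_self (norm_ne_zero_iff.2 hA0)] at this
        exact (pow_eq_one_iff_of_nonneg (norm_nonneg _) (by norm_num)).1 this
      refine ⟨u, hu1, ?_⟩
      have h1 : u * conj u = 1 := by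
        rw [Complex.mul_conj, Complex.normSq_eq_norm_sq, hu1]; simp
      have h2 : u ^ 2 * A = -B := by rw [hu, div_mul_cancel₀ _ hA0]
      linear_combination conj u * h2 - u * A * h1
  have hu0 : u ≠ 0 := norm_ne_zero_iff.1 (by rw [hu]; norm_num)
  obtain ⟨f, hf, hdeg, hst⟩ := exists_stablyHyperbolic hn hu0 hw
  refine hz.ne' ((H f hdeg hst).2 z ?_)
  rw [hf, ← smul_eq_C_mul, ← smul_eq_C_mul, map_add, map_smul, map_smul, eval_add, eval_smul,
    eval_smul]
  exact huAB

open ComplexConjugate in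
-- A zero of the first term makes the difference of moduli non-positive, a zero of the second makes
-- it non-negative; the difference would then vanish somewhere on the connected product of
-- half-planes.
theorem stable_or_stable_conj {L : ℂ[X] →ₗ[ℂ] ℂ[X]} {n : ℕ} (hn : 0 < n)
    (H : ∀ f : ℝ[X], f.natDegree ≤ n → StablyHyperbolic n f → RealRooted (L (toComplex f))) :
    (∀ z w : ℂ, 0 < z.im → 0 < w.im → (L ((X + C w) ^ n)).eval z ≠ 0) ∨
      ∀ z w : ℂ, 0 < z.im → 0 < w.im → (L ((X + C (conj w)) ^ n)).eval z ≠ 0 := by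
  by_contra! hcon
  obtain ⟨⟨z₁, w₁, hz₁, hw₁, h₁⟩, z₂, w₂, hz₂, hw₂, h₂⟩ := hcon
  have hdeg : ∀ w : ℂ, ((X + C w : ℂ[X]) ^ n).natDegree ≤ n := fun w => by
    rw [natDegree_pow, natDegree_X_add_C, mul_one]
  have hcont : Continuous fun p : ℂ × ℂ => (L ((X + C p.2) ^ n)).eval p.1 := by
    have : (fun p : ℂ × ℂ => (L ((X + C p.2) ^ n)).eval p.1) = fun p : ℂ × ℂ =>
        ∑ k ∈ Finset.range (n + 1), (p.2 ^ (n - k) * n.choose k) * (L (X ^ k)).eval p.1 := by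
      ext p
      rw [L.map_eq_sum_coeff (hdeg p.2), eval_finsetSum]
      simp [coeff_X_add_C_pow]
    rw [this]
    fun_prop
  have hcont2 : Continuous fun p : ℂ × ℂ =>
      ‖(L ((X + C p.2) ^ n)).eval p.1‖ - ‖(L ((X + C (conj p.2)) ^ n)).eval p.1‖ := by
    refine hcont.norm.sub (Continuous.norm ?_)
    exact hcont.comp (continuous_fst.prodMk (Complex.continuous_conj.comp continuous_snd))
  have hconn : IsPreconnected ({z : ℂ | 0 < z.im} ×ˢ {w : ℂ | 0 < w.im}) :=
    (convex_halfSpace_im_gt 0).isPreconnected.prod (convex_halfSpace_im_gt 0).isPreconnected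
  obtain ⟨⟨z, w⟩, ⟨hz, hw⟩, h0⟩ := hconn.intermediate_value (a := (z₁, w₁)) (b := (z₂, w₂))
    ⟨hz₁, hw₁⟩ ⟨hz₂, hw₂⟩ hcont2.continuousOn (show (0 : ℝ) ∈ _ from by
      constructor <;> simp [h₁, h₂])
  exact norm_eval_ne_norm_eval_conj hn H hz hw (sub_eq_zero.1 h0)

/-- The necessary conditions for a linear operator to preserve real-rootedness. -/
theorem classification_of_preserves {L : ℂ[X] →ₗ[ℂ] ℂ[X]} {n : ℕ} (hn : 0 < n)
    (H : ∀ f : ℂ[X], RealRooted f → f.natDegree ≤ n → RealRooted (L f) ∨ L f = 0) :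
    HasParallelRange L n ∨ HasInterlacingRange L n ∨
      ∃ c : ℂ, c ≠ 0 ∧
        (∀ g : ℝ[X], g.natDegree ≤ n → ∃ s : ℝ[X], L (toComplex g) = c • toComplex s) ∧
        ((∀ z w : ℂ, 0 < z.im → 0 < w.im → (L ((X + C w) ^ n)).eval z ≠ 0) ∨
          ∀ z w : ℂ, 0 < z.im → 0 < w.im → (L ((X - C w) ^ n)).eval z ≠ 0) := by
  have HR : ∀ f : ℝ[X], Hyperbolic f → f.natDegree ≤ n →
      RealRooted (L (toComplex f)) ∨ L (toComplex f) = 0 := by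
    intro f hf hdeg
    refine H _ ?_ (natDegree_map_le.trans hdeg)
    simpa using hf.realRooted_smul one_ne_zero
  have Hpert : ∀ f : ℝ[X], f.natDegree ≤ n → StablyHyperbolic n f → ∀ g : ℝ[X], g.natDegree ≤ n →
      ∀ᶠ ε : ℝ in nhds 0, RealRooted (L (toComplex f) + (ε : ℂ) • L (toComplex g)) ∨
        L (toComplex f) + (ε : ℂ) • L (toComplex g) = 0 := by
    intro f hf hst g hg
    filter_upwards [hst g hg] with ε hε
    have := HR _ hε (natDegree_add_le_of_degree_le hf ((natDegree_smul_le _ _).trans hg))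
    rwa [toComplex_add, toComplex_smul, map_add, map_smul] at this
  by_cases hker : ∃ f : ℝ[X], f.natDegree ≤ n ∧ StablyHyperbolic n f ∧ L (toComplex f) = 0
  · obtain ⟨f, hf, hst, h0⟩ := hker
    rw [← or_assoc]
    refine Or.inl (parallel_or_interlacing_range fun g hg => ?_)
    obtain ⟨ε, hε, hpos⟩ := (((Hpert f hf hst g hg).filter_mono nhdsWithin_le_nhds).and
      (self_mem_nhdsWithin : Set.Ioi (0 : ℝ) ∈ nhdsWithin 0 (Set.Ioi 0))).exists
    have hεC : (ε : ℂ) ≠ 0 := by exact_mod_cast (ne_of_gt hpos)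
    rw [h0, zero_add] at hε
    refine hε.imp (fun h => ?_) fun h => (smul_eq_zero.1 h).resolve_left hεC
    refine ⟨right_ne_zero_of_smul h.1, fun z hz => h.2 z ?_⟩
    rw [eval_smul, hz, smul_zero]
  · push Not at hker
    have hne : ∀ f : ℝ[X], f.natDegree ≤ n → StablyHyperbolic n f →
        RealRooted (L (toComplex f)) := by
      intro f hf hst
      have h1 : Hyperbolic f := by
        have := (hst 0 (by simp)).self_of_nhds
        simpa using this
      exact (HR f h1 hf).resolve_right (hker f hf hst)
    -- Any one stably hyperbolic polynomial will do; its image supplies the common factor `c`.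
    obtain ⟨f, -, hf, hst⟩ :=
      exists_stablyHyperbolic hn (one_ne_zero (α := ℂ)) (w := Complex.I) (by simp)
    obtain ⟨c, r, hc, hr, hL⟩ := (hne f hf hst).exists_smul_toComplex
    have hdich := real_or_parallel_range (L := L) (n := n) hc hr.1 fun g hg => by
      simpa only [hL] using Hpert f hf hst g hg
    rcases hdich with hpar | hreal
    · exact Or.inl ⟨r, hr, hpar⟩
    refine Or.inr (Or.inr ⟨c, hc, hreal, ?_⟩)
    refine (stable_or_stable_conj hn hne).imp id fun h z w hz hw => ?_
    -- The reflection `w ↦ -w̄` preserves the upper half-plane and turns `X + w̄` into `X - w`.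
    have := h z (-starRingEnd ℂ w) hz (by simpa using hw)
    simpa [sub_eq_add_neg] using this

/-! ### The symbol of an operator -/

theorem coeff_aeval_X_zero_mul_X_one_pow (p : ℂ[X]) (l : ℕ) (m : Fin 2 →₀ ℕ) :
    (aeval (MvPolynomial.X 0 : MvPolynomial (Fin 2) ℂ) p * MvPolynomial.X 1 ^ l).coeff m =
      if m 1 = l then p.coeff (m 0) else 0 := by
  induction p using Polynomial.induction_on' with
  | add p q hp hq =>
    rw [map_add, add_mul, MvPolynomial.coeff_add, hp, hq]
    split_ifs <;> simp
  | monomial i a =>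
    have h1 : aeval (MvPolynomial.X 0 : MvPolynomial (Fin 2) ℂ) (monomial i a) *
        MvPolynomial.X 1 ^ l =
        MvPolynomial.monomial (Finsupp.single 0 i + Finsupp.single 1 l) a := by
      rw [aeval_monomial, MvPolynomial.X_pow_eq_monomial, MvPolynomial.X_pow_eq_monomial,
        MvPolynomial.algebraMap_eq, MvPolynomial.C_mul_monomial, MvPolynomial.monomial_mul]
      simp
    have h2 : Finsupp.single 0 i + Finsupp.single 1 l = m ↔ m 1 = l ∧ m 0 = i := by
      constructor
      · rintro rfl; simp
      · rintro ⟨rfl, rfl⟩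
        ext j; fin_cases j <;> simp
    rw [h1, MvPolynomial.coeff_monomial, coeff_monomial]
    simp only [h2, eq_comm (a := i)]
    split_ifs <;> simp_all

section Symbol

variable {n : ℕ} {T : degreeLE ℂ (n : WithBot ℕ) →ₗ[ℂ] ℂ[X]} {L : ℂ[X] →ₗ[ℂ] ℂ[X]}

/-- The parameter `s = ±1` lets one expansion serve both symbols. -/
theorem extendTwo_X_add_pow (hL : ∀ f : degreeLE ℂ (n : WithBot ℕ), L f = T f) (s : ℂ) :
    extendTwo T ((MvPolynomial.X 0 + MvPolynomial.C s * MvPolynomial.X 1) ^ n) =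
      ∑ k ∈ Finset.range (n + 1), (s ^ (n - k) * n.choose k) •
        (aeval (MvPolynomial.X 0) (L (X ^ k)) * MvPolynomial.X 1 ^ (n - k)) := by
  rw [add_pow, map_sum]
  refine Finset.sum_congr rfl fun k hk => ?_
  have hkn : k ≤ n := Nat.lt_succ_iff.1 (Finset.mem_range.1 hk)
  have h1 : (MvPolynomial.X 0 : MvPolynomial (Fin 2) ℂ) ^ k *
      (MvPolynomial.C s * MvPolynomial.X 1) ^ (n - k) * ((n.choose k : ℕ) : MvPolynomial (Fin 2) ℂ) =
      (s ^ (n - k) * n.choose k) • MvPolynomial.basisMonomials (Fin 2) ℂ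
        (Finsupp.single 0 k + Finsupp.single 1 (n - k)) := by
    rw [MvPolynomial.coe_basisMonomials, MvPolynomial.smul_eq_C_mul, mul_pow]
    beta_reduce
    rw [show (MvPolynomial.monomial (Finsupp.single (0 : Fin 2) k + Finsupp.single 1 (n - k)))
      (1 : ℂ) = MvPolynomial.X 0 ^ k * MvPolynomial.X 1 ^ (n - k) by
        rw [MvPolynomial.X_pow_eq_monomial, MvPolynomial.X_pow_eq_monomial,
          MvPolynomial.monomial_mul, one_mul]]
    simp only [MvPolynomial.C_mul, MvPolynomial.C_pow, map_natCast]
    ring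
  rw [h1, map_smul, extendTwo, Module.Basis.constr_basis]
  have h2 : (Finsupp.single (0 : Fin 2) k + Finsupp.single 1 (n - k) : Fin 2 →₀ ℕ) 0 = k := by simp
  have h3 : (Finsupp.single (0 : Fin 2) k + Finsupp.single 1 (n - k) : Fin 2 →₀ ℕ) 1 = n - k := by
    simp
  have h4 : ∀ (i : ℕ) (hi : i ≤ n), T (monomialLE n i hi) = L (X ^ i) := fun i hi =>
    (hL (monomialLE n i hi)).symm
  simp only [h2, h3, h4, hkn, dif_pos]

theorem eval_extendTwo (hL : ∀ f : degreeLE ℂ (n : WithBot ℕ), L f = T f) (s : ℂ)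
    (z : Fin 2 → ℂ) :
    MvPolynomial.eval z
        (extendTwo T ((MvPolynomial.X 0 + MvPolynomial.C s * MvPolynomial.X 1) ^ n)) =
      (L ((X + C (s * z 1)) ^ n)).eval (z 0) := by
  have hdeg : ((X + C (s * z 1) : ℂ[X]) ^ n).natDegree ≤ n := by
    rw [natDegree_pow, natDegree_X_add_C, mul_one]
  rw [extendTwo_X_add_pow hL, L.map_eq_sum_coeff hdeg, map_sum, eval_finsetSum]
  refine Finset.sum_congr rfl fun k _ => ?_
  have h1 : MvPolynomial.eval z (aeval (MvPolynomial.X 0) (L (X ^ k))) =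
      (L (X ^ k)).eval (z 0) := by
    have h2 := aeval_algHom_apply (MvPolynomial.aeval z : MvPolynomial (Fin 2) ℂ →ₐ[ℂ] ℂ)
      (MvPolynomial.X 0) (L (X ^ k))
    rw [MvPolynomial.aeval_X] at h2
    exact h2.symm
  rw [MvPolynomial.smul_eval, map_mul, h1, coeff_X_add_C_pow, eval_smul, smul_eq_mul,
    RingHom.map_pow, MvPolynomial.eval_X, mul_pow]
  ring

theorem coeff_extendTwo (hL : ∀ f : degreeLE ℂ (n : WithBot ℕ), L f = T f) (s : ℂ)
    (m : Fin 2 →₀ ℕ) :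
    (extendTwo T ((MvPolynomial.X 0 + MvPolynomial.C s * MvPolynomial.X 1) ^ n)).coeff m =
      if m 1 ≤ n then s ^ m 1 * n.choose (m 1) * (L (X ^ (n - m 1))).coeff (m 0) else 0 := by
  rw [extendTwo_X_add_pow hL, MvPolynomial.coeff_sum]
  simp only [MvPolynomial.coeff_smul, coeff_aeval_X_zero_mul_X_one_pow, smul_eq_mul]
  split_ifs with h
  · rw [Finset.sum_eq_single (n - m 1)]
    · rw [if_pos (by omega), Nat.sub_sub_self h, Nat.choose_symm h]
    · intro k hk hne
      rw [if_neg, mul_zero]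
      have := Finset.mem_range.1 hk
      omega
    · intro hk
      exact absurd (Finset.mem_range.2 (by omega)) hk
  · refine Finset.sum_eq_zero fun k hk => ?_
    rw [if_neg (by omega), mul_zero]

theorem isRealStable_extendTwo {s : ℝ} (hL : ∀ f : degreeLE ℂ (n : WithBot ℕ), L f = T f) {c : ℂ}
    (hc : c ≠ 0) (hreal : ∀ g : ℝ[X], g.natDegree ≤ n → ∃ r : ℝ[X], L (toComplex g) = c • toComplex r)
    (hst : ∀ z w : ℂ, 0 < z.im → 0 < w.im → (L ((X + C (s * w)) ^ n)).eval z ≠ 0) :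
    IsRealStable (c⁻¹ • extendTwo T
      ((MvPolynomial.X 0 + MvPolynomial.C (s : ℂ) * MvPolynomial.X 1) ^ n)) := by
  refine ⟨fun z hz => ?_, fun m => ?_⟩
  · rw [MvPolynomial.smul_eval, eval_extendTwo hL]
    exact mul_ne_zero (inv_ne_zero hc) (hst _ _ (hz 0) (hz 1))
  · rw [MvPolynomial.coeff_smul, coeff_extendTwo hL, smul_eq_mul]
    split_ifs with h
    · obtain ⟨r, hr⟩ := hreal (X ^ (n - m 1)) (by simp)
      rw [show toComplex (X ^ (n - m 1)) = X ^ (n - m 1) by simp [toComplex]] at hr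
      rw [hr, coeff_smul, toComplex_coeff, smul_eq_mul]
      have : c⁻¹ * ((s : ℂ) ^ m 1 * n.choose (m 1) * (c * r.coeff (m 0))) =
          ((s ^ m 1 * n.choose (m 1) * r.coeff (m 0) : ℝ) : ℂ) := by
        push_cast
        field_simp
      rw [this, Complex.ofReal_im]
    · simp

/-- The substitution `X ↦ sX` is an involution preserving real-rootedness and sends `(X + w)^n` to
`s^n(X + sw)^n`, which reduces both signs to the positive one. -/
theorem realRooted_map_of_isRealStable {s : ℝ} (hs : s * s = 1)
    (hL : ∀ f : degreeLE ℂ (n : WithBot ℕ), L f = T f) {η : ℂ}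
    (hst : IsRealStable (η • extendTwo T
      ((MvPolynomial.X 0 + MvPolynomial.C (s : ℂ) * MvPolynomial.X 1) ^ n)))
    {f : ℂ[X]} (hf : RealRooted f) (hdeg : f.natDegree ≤ n) : RealRooted (L f) ∨ L f = 0 := by
  have hs0 : s ≠ 0 := left_ne_zero_of_mul (hs.symm ▸ one_ne_zero)
  have hsC : (s : ℂ) ≠ 0 := by exact_mod_cast hs0
  have hsC1 : (s : ℂ) * s = 1 := by exact_mod_cast hs
  have hne : ∀ z w : ℂ, 0 < z.im → 0 < w.im → η * (L ((X + C (s * w)) ^ n)).eval z ≠ 0 := by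
    intro z w hz hw
    have := hst.1 ![z, w] (fun j => by fin_cases j <;> simpa)
    rwa [MvPolynomial.smul_eval, eval_extendTwo hL] at this
  have hη : η ≠ 0 := left_ne_zero_of_mul (hne Complex.I Complex.I (by simp) (by simp))
  have hcomp : ∀ g : ℂ[X], (aeval (C (s : ℂ) * X : ℂ[X])).toLinearMap g = g.comp (C (s : ℂ) * X) :=
    fun g => rfl
  have hcc : ∀ g : ℂ[X], (g.comp (C (s : ℂ) * X)).comp (C (s : ℂ) * X) = g := by
    intro g
    rw [comp_assoc, mul_comp, C_comp, X_comp, ← mul_assoc, ← C_mul, hsC1, C_1, one_mul, comp_X]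
  have key := realRooted_map_of_stable (L := L ∘ₗ (aeval (C (s : ℂ) * X : ℂ[X])).toLinearMap)
    (n := n) (c := η⁻¹) (f := f.comp (C (s : ℂ) * X)) ?_ ?_ ?_ ?_
  · rwa [LinearMap.comp_apply, hcomp, hcc] at key
  · intro z w hz hw
    have h1 : ((X + C w) ^ n).comp (C (s : ℂ) * X) = (s : ℂ) ^ n • (X + C (s * w)) ^ n := by
      rw [pow_comp, add_comp, X_comp, C_comp, smul_eq_C_mul, C_pow, ← mul_pow, mul_add, ← C_mul,
        ← mul_assoc, hsC1, one_mul]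
    rw [LinearMap.comp_apply, hcomp, h1, map_smul, eval_smul, smul_eq_mul]
    exact mul_ne_zero (pow_ne_zero _ hsC) (right_ne_zero_of_mul (hne z w hz hw))
  · intro k hk
    have h1 : ((X : ℂ[X]) ^ k).comp (C (s : ℂ) * X) = (s : ℂ) ^ k • X ^ k := by
      rw [pow_comp, X_comp, smul_eq_C_mul, C_pow, mul_pow]
    have h2 : ∀ i, ((η • L (X ^ k)).coeff i).im = 0 := by
      intro i
      -- The part of the symbol of degree `n - k` in `w` is a non-zero real multiple of `ηL(X^k)`.
      have h3 := hst.2 (Finsupp.single 0 i + Finsupp.single 1 (n - k))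
      rw [MvPolynomial.coeff_smul, coeff_extendTwo hL] at h3
      simp only [Finsupp.add_apply, Finsupp.single_eq_same, ne_eq, one_ne_zero, not_false_eq_true,
        Finsupp.single_eq_of_ne, zero_add, zero_ne_one, add_zero, tsub_le_iff_right,
        le_add_iff_nonneg_right, zero_le, if_true, smul_eq_mul, Nat.sub_sub_self hk] at h3
      have h4 : η * ((s : ℂ) ^ (n - k) * n.choose (n - k) * (L (X ^ k)).coeff i) =
          ((s ^ (n - k) * n.choose (n - k) : ℝ) : ℂ) * (η • L (X ^ k)).coeff i := by
        rw [coeff_smul, smul_eq_mul]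
        push_cast
        ring
      rw [h4, Complex.im_ofReal_mul] at h3
      refine (mul_eq_zero.1 h3).resolve_left (mul_ne_zero (pow_ne_zero _ hs0) ?_)
      exact_mod_cast (Nat.choose_pos (Nat.sub_le n k)).ne'
    obtain ⟨r, hr⟩ := exists_toComplex_eq h2
    refine ⟨s ^ k • r, ?_⟩
    rw [LinearMap.comp_apply, hcomp, h1, map_smul, toComplex_smul, hr, smul_comm η⁻¹,
      inv_smul_smul₀ hη]
    push_cast
    rfl
  · refine ⟨fun h0 => hf.1 ?_, fun z hz => ?_⟩
    · rw [← hcc f, h0, zero_comp]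
    · rw [eval_comp, eval_mul, eval_C, eval_X] at hz
      have := hf.2 _ hz
      rw [Complex.im_ofReal_mul] at this
      exact (mul_eq_zero.1 this).resolve_left hs0
  · refine natDegree_comp_le.trans ?_
    rw [natDegree_C_mul_X _ hsC, mul_one]
    exact hdeg

end Symbol

/-- Degree zero is separate: `2 Re u` can vanish for `u ≠ 0`, so the perturbation argument has no
starting point, but the domain is a line. -/
theorem hasParallelRange_zero {L : ℂ[X] →ₗ[ℂ] ℂ[X]}
    (H : ∀ f : ℂ[X], RealRooted f → f.natDegree ≤ 0 → RealRooted (L f) ∨ L f = 0) :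
    HasParallelRange L 0 := by
  have hconst : ∀ g : ℝ[X], g.natDegree ≤ 0 → L (toComplex g) = (g.coeff 0 : ℂ) • L 1 := by
    intro g hg
    rw [← map_smul, eq_C_of_natDegree_le_zero hg]
    simp [toComplex, smul_eq_C_mul]
  rcases H 1 ⟨one_ne_zero, fun z hz => by simp at hz⟩ (by simp) with h | h
  · obtain ⟨c, P, -, hP, hL⟩ := h.exists_smul_toComplex
    refine ⟨P, hP, fun g hg => ⟨g.coeff 0 * c, ?_⟩⟩
    rw [hconst g hg, hL, smul_smul]
  · refine ⟨1, ⟨one_ne_zero, fun z hz => by simp at hz⟩, fun g hg => ⟨0, ?_⟩⟩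
    rw [hconst g hg, h, smul_zero, zero_smul]

/-! ### Operators with small range -/

section SmallRange

variable {n : ℕ} {T : degreeLE ℂ (n : WithBot ℕ) →ₗ[ℂ] ℂ[X]} {L : ℂ[X] →ₗ[ℂ] ℂ[X]}

/-- The linear functional with given values at the monomials. -/
noncomputable def coeffFunctional (n : ℕ) (a : ℕ → ℂ) : degreeLE ℂ (n : WithBot ℕ) →ₗ[ℂ] ℂ :=
  (∑ k ∈ Finset.range (n + 1), a k • lcoeff ℂ k) ∘ₗ (degreeLE ℂ (n : WithBot ℕ)).subtype

theorem coeffFunctional_apply (a : ℕ → ℂ) (f : degreeLE ℂ (n : WithBot ℕ)) :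
    coeffFunctional n a f = ∑ k ∈ Finset.range (n + 1), a k * (f : ℂ[X]).coeff k := by
  simp [coeffFunctional]

theorem realOnReal_coeffFunctional (a : ℕ → ℝ) :
    RealOnReal (coeffFunctional n fun k => (a k : ℂ)) := by
  intro f hf
  rw [coeffFunctional_apply, Complex.im_sum]
  refine Finset.sum_eq_zero fun k _ => ?_
  rw [Complex.im_ofReal_mul, hf, mul_zero]

theorem natDegree_le_of_degreeLE (f : degreeLE ℂ (n : WithBot ℕ)) : (f : ℂ[X]).natDegree ≤ n :=
  natDegree_le_iff_degree_le.2 (mem_degreeLE.1 f.2)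

theorem HasParallelRange.exists_functional (hL : ∀ f : degreeLE ℂ (n : WithBot ℕ), L f = T f)
    (h : HasParallelRange L n) :
    T.rank ≤ 1 ∧ ∃ (α : degreeLE ℂ (n : WithBot ℕ) →ₗ[ℂ] ℂ) (P : ℝ[X]),
      Hyperbolic P ∧ ∀ f, T f = α f • toComplex P := by
  obtain ⟨P, hP, h⟩ := h
  have hX : ∀ k ≤ n, ∃ l : ℂ, L (X ^ k) = l • toComplex P := fun k hk => by
    simpa [toComplex] using h (X ^ k) (by simpa using hk)
  choose! l hl using hX
  have hT : ∀ f, T f = coeffFunctional n l f • toComplex P := by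
    intro f
    rw [← hL, L.map_eq_sum_coeff (natDegree_le_of_degreeLE f), coeffFunctional_apply,
      Finset.sum_smul]
    refine Finset.sum_congr rfl fun k hk => ?_
    rw [hl k (Nat.lt_succ_iff.1 (Finset.mem_range.1 hk)), smul_smul, mul_comm]
  refine ⟨?_, _, P, hP, hT⟩
  have hle : T.range ≤ Submodule.span ℂ (({toComplex P} : Finset ℂ[X]) : Set ℂ[X]) := by
    rintro _ ⟨f, rfl⟩
    rw [hT]
    exact Submodule.smul_mem _ _ (Submodule.subset_span (by simp))
  exact (Submodule.rank_mono hle).trans ((rank_span_finset_le _).trans (by simp))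

theorem HasInterlacingRange.exists_functionals (hL : ∀ f : degreeLE ℂ (n : WithBot ℕ), L f = T f)
    (h : HasInterlacingRange L n) :
    T.rank ≤ 2 ∧ ∃ (η : ℂ) (α β : degreeLE ℂ (n : WithBot ℕ) →ₗ[ℂ] ℂ) (P Q : ℝ[X]),
      RealOnReal α ∧ RealOnReal β ∧ Hyperbolic P ∧ Hyperbolic Q ∧ ZerosInterlace P Q ∧
        ∀ f, T f = (η * α f) • toComplex P + (η * β f) • toComplex Q := by
  obtain ⟨c, P, Q, hP, hQ, hPQ, h⟩ := h
  have hX : ∀ k ≤ n, ∃ a b : ℝ, L (X ^ k) = c • (a • toComplex P + b • toComplex Q) := fun k hk => by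
    simpa [toComplex] using h (X ^ k) (by simpa using hk)
  choose! a b hab using hX
  have hT : ∀ f, T f = (c * coeffFunctional n (fun k => (a k : ℂ)) f) • toComplex P +
      (c * coeffFunctional n (fun k => (b k : ℂ)) f) • toComplex Q := by
    intro f
    rw [← hL, L.map_eq_sum_coeff (natDegree_le_of_degreeLE f), coeffFunctional_apply,
      coeffFunctional_apply, Finset.mul_sum, Finset.mul_sum, Finset.sum_smul, Finset.sum_smul,
      ← Finset.sum_add_distrib]
    refine Finset.sum_congr rfl fun k hk => ?_
    rw [hab k (Nat.lt_succ_iff.1 (Finset.mem_range.1 hk)), ← Complex.coe_smul, ← Complex.coe_smul]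
    module
  refine ⟨?_, c, _, _, P, Q, realOnReal_coeffFunctional a, realOnReal_coeffFunctional b, hP, hQ,
    hPQ, hT⟩
  classical
  have hle : T.range ≤
      Submodule.span ℂ (({toComplex P, toComplex Q} : Finset ℂ[X]) : Set ℂ[X]) := by
    rintro _ ⟨f, rfl⟩
    rw [hT]
    exact add_mem (Submodule.smul_mem _ _ (Submodule.subset_span (by simp)))
      (Submodule.smul_mem _ _ (Submodule.subset_span (by simp)))
  refine (Submodule.rank_mono hle).trans ((rank_span_finset_le _).trans ?_)
  exact_mod_cast Finset.card_le_two

/-- Up to a constant `f` is real, and the functionals are real there, so the image is a multiple of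
a real combination of `P` and `Q`. -/
theorem realRooted_map_of_interlacing {η : ℂ} {α β : degreeLE ℂ (n : WithBot ℕ) →ₗ[ℂ] ℂ} {P Q : ℝ[X]}
    (hα : RealOnReal α) (hβ : RealOnReal β) (hP : Hyperbolic P) (hQ : Hyperbolic Q)
    (hPQ : ZerosInterlace P Q)
    (hT : ∀ f, T f = (η * α f) • toComplex P + (η * β f) • toComplex Q)
    {f : degreeLE ℂ (n : WithBot ℕ)} (hf : RealRooted (f : ℂ[X])) : RealRooted (T f) ∨ T f = 0 := by
  obtain ⟨c, g, hc, hg, hfg⟩ := hf.exists_smul_toComplex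
  have hmem : toComplex g ∈ degreeLE ℂ (n : WithBot ℕ) := by
    have : toComplex g = c⁻¹ • (f : ℂ[X]) := by rw [hfg, inv_smul_smul₀ hc]
    rw [this]
    exact Submodule.smul_mem _ _ f.2
  have hfg' : f = c • (⟨toComplex g, hmem⟩ : degreeLE ℂ (n : WithBot ℕ)) := Subtype.ext hfg
  set g' : degreeLE ℂ (n : WithBot ℕ) := ⟨toComplex g, hmem⟩
  have hα' : α g' = ((α g').re : ℂ) := Complex.ext rfl (by simpa using hα g' (by simp [g']))
  have hβ' : β g' = ((β g').re : ℂ) := Complex.ext rfl (by simpa using hβ g' (by simp [g']))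
  have hTf : T f = (c * η) • toComplex ((α g').re • P + (β g').re • Q) := by
    rw [hfg', map_smul, hT, hα', hβ']
    simp only [toComplex_add, toComplex_smul, Complex.ofReal_re]
    module
  rw [hTf]
  by_cases h0 : (c * η) • toComplex ((α g').re • P + (β g').re • Q) = 0
  · exact Or.inr h0
  · refine Or.inl ((hPQ.hyperbolic_add hP hQ ?_).realRooted_smul (left_ne_zero_of_smul h0))
    exact fun h => right_ne_zero_of_smul h0 (toComplex_eq_zero.2 h)

end SmallRange

/-! ### The classification -/

theorem theorem2p6 (n : ℕ) (T : degreeLE ℂ (n : WithBot ℕ) →ₗ[ℂ] ℂ[X]) :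
    (∀ f : degreeLE ℂ (n : WithBot ℕ),
        RealRooted (f : ℂ[X]) → RealRooted (T f) ∨ T f = 0) ↔
      ((T.rank ≤ 1 ∧
          ∃ (α : degreeLE ℂ (n : WithBot ℕ) →ₗ[ℂ] ℂ) (P : ℝ[X]),
            Hyperbolic P ∧ ∀ f, T f = α f • toComplex P) ∨
        (T.rank ≤ 2 ∧
          ∃ (η : ℂ) (α β : degreeLE ℂ (n : WithBot ℕ) →ₗ[ℂ] ℂ) (P Q : ℝ[X]),
            RealOnReal α ∧ RealOnReal β ∧ Hyperbolic P ∧ Hyperbolic Q ∧ ZerosInterlace P Q ∧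
              ∀ f, T f = (η * α f) • toComplex P + (η * β f) • toComplex Q) ∨
        (∃ η : ℂ, IsRealStable
          (η • extendTwo T ((MvPolynomial.X 0 + MvPolynomial.X 1) ^ n))) ∨
        (∃ η : ℂ, IsRealStable
          (η • extendTwo T ((MvPolynomial.X 0 - MvPolynomial.X 1) ^ n)))) := by
  -- An arbitrary linear extension to all polynomials; only its values in degree at most `n` matter.
  obtain ⟨L, hLT⟩ := LinearMap.exists_extend T
  have hL : ∀ f : degreeLE ℂ (n : WithBot ℕ), L f = T f := fun f => by rw [← hLT]; rfl
  have hplus : (MvPolynomial.X 0 + MvPolynomial.X 1 : MvPolynomial (Fin 2) ℂ) =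
      MvPolynomial.X 0 + MvPolynomial.C ((1 : ℝ) : ℂ) * MvPolynomial.X 1 := by simp
  have hminus : (MvPolynomial.X 0 - MvPolynomial.X 1 : MvPolynomial (Fin 2) ℂ) =
      MvPolynomial.X 0 + MvPolynomial.C ((-1 : ℝ) : ℂ) * MvPolynomial.X 1 := by
    simp [sub_eq_add_neg]
  rw [hplus, hminus]
  constructor
  · intro H
    have HL : ∀ f : ℂ[X], RealRooted f → f.natDegree ≤ n → RealRooted (L f) ∨ L f = 0 := by
      intro f hf hdeg
      have := H ⟨f, mem_degreeLE.2 (natDegree_le_iff_degree_le.1 hdeg)⟩ hf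
      rwa [← hL] at this
    rcases n.eq_zero_or_pos with rfl | hn
    · exact Or.inl ((hasParallelRange_zero HL).exists_functional hL)
    rcases classification_of_preserves hn HL with h | h | ⟨c, hc, hreal, hst | hst⟩
    · exact Or.inl (h.exists_functional hL)
    · exact Or.inr (Or.inl (h.exists_functionals hL))
    · refine Or.inr (Or.inr (Or.inl ⟨c⁻¹, isRealStable_extendTwo hL hc hreal ?_⟩))
      simpa using hst
    · refine Or.inr (Or.inr (Or.inr ⟨c⁻¹, isRealStable_extendTwo hL hc hreal ?_⟩))
      simpa [sub_eq_add_neg] using hst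
  · rintro (⟨-, α, P, hP, hT⟩ | ⟨-, η, α, β, P, Q, hα, hβ, hP, hQ, hPQ, hT⟩ | ⟨η, hst⟩ | ⟨η, hst⟩)
      f hf
    · rw [hT]
      by_cases h0 : α f = 0
      · exact Or.inr (by rw [h0, zero_smul])
      · exact Or.inl (hP.realRooted_smul h0)
    · exact realRooted_map_of_interlacing hα hβ hP hQ hPQ hT hf
    · rw [← hL]
      exact realRooted_map_of_isRealStable (by norm_num) hL hst hf (natDegree_le_of_degreeLE f)
    · rw [← hL]
      exact realRooted_map_of_isRealStable (by norm_num) hL hst hf (natDegree_le_of_degreeLE f)
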